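/- Let $N\ge 1$, $p\ge 0$, and let $q_1,\dots,q_N:\mathbb R^p\to\mathbb R$ (the margins $q_i(w)=y_i\Phi(w,x_i)$ of a network $\Phi$ on the training data). Let $\ell=e^{-f}$ be the exponential loss, $f(x)=x$, or the logistic loss, $f(x)=-\log\log(1+e^{-x})$, and let $\mathcal L(w)=\sum_{i=1}^N e^{-f(q_i(w))}$. For a locally Lipschitz function $\varphi$, let $\partial^\circ\varphi$ denote its Clarke subdifferential. Assume: (I) every $q_i$ is locally Lipschitz and admits a chain rule: for every absolutely continuous curve $z$ on a compact interval and almost every $t$, $\frac{d}{dt}q_i(z(t))=\langle \xi,z'(t)\rangle$ for all $\xi\in\partial^\circ q_i(z(t))$; (II) there is $L>0$ such that $q_i(\alpha w)=\alpha^L q_i(w)$ for all $i$, all $\alpha>0$ and all $w\in\mathbb R^p$. Let $0\le b\le 1$ and $\varepsilon>0$, and let $w:[0,\infty)\to\mathbb R^p$ be an RMSProp flow, i.e. $w$ is absolutely continuous on compact intervals and there is a measurable $g$ with, for almost every $t\ge 0$, $$g(t)\in\partial^\circ\mathcal L(w(t)),\qquad w'(t)=-h(t)\odot g(t),\qquad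 h_j(t)^{-1}=\sqrt{\varepsilon+\int_0^t(1-b)e^{-(1-b)(t-\tau)}g_j(\tau)^2\,d\tau}\quad(j=1,\dots,p).$$ (III) Assume that there is a time $t_0\ge 0$ with $f^{-1}\!\left(\log\frac1{\mathcal L(w(t_0))}\right)>0$. Then every limit point $\bar w$, as $t\to\infty$, of $w(t)/\|w(t)\|$ is along the direction of a KKT point of $$\min\ \tfrac12\|w\|\quad\text{subject to } q_i(w)\ge 1,\ i=1,\dots,N,$$ that is, there is $c>0$ such that $v=c\bar w$ is a KKT point of this problem; the same $v$ is also a KKT point of the $L^2$ max-margin problem $\min\frac12\|w\|^2$ subject to $q_i(w)\ge1$. Here a KKT point of $\min\varphi(w)$ subject to $c_i(w)\le 0$ $(i=1,\dots,N)$ is a feasible point $v$ for which there are $\lambda_i\ge 0$, $k\in\partial^\circ\varphi(v)$ and $\xi_i\in\partial^\circ c_i(v)$ with $k+\sum_i\lambda_i\xi_i=0$ and $\lambda_ic_i(v)=0$ for all $i$; it is applied with $c_i=1-q_i$. -/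

import Mathlib

open MeasureTheory Filter Topology

noncomputable section

/-- The two individual losses `ℓ = e^{-f}`: the exponential and the logistic loss. -/
inductive LossKind where
  | exponential
  | logistic

/-- The function `f` with `ℓ(x) = e^{-f(x)}`: `f(x) = x` for the exponential loss `e^{-x}` and
`f(x) = -log log (1 + e^{-x})` for the logistic loss `log (1 + e^{-x})`. -/
def LossKind.f : LossKind → ℝ → ℝ
  | .exponential => fun x => x
  | .logistic => fun x => -Real.log (Real.log (1 + Real.exp (-x)))

/-- The inverse function `f⁻¹` of the increasing bijection `f : ℝ → ℝ`. -/
def LossKind.fInv (ℓ : LossKind) : ℝ → ℝ := Function.invFun ℓ.f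

/-- The empirical loss `𝓛(w) = ∑ i, e^{-f(q_i(w))}`. -/
def empiricalLoss {p N : ℕ} (ℓ : LossKind) (q : Fin N → EuclideanSpace ℝ (Fin p) → ℝ)
    (w : EuclideanSpace ℝ (Fin p)) : ℝ :=
  ∑ i, Real.exp (-(ℓ.f (q i w)))

/-- Clarke's generalized directional derivative
`φ°(x; v) = limsup_{y → x, s ↓ 0} (φ(y + s v) - φ(y)) / s` of a locally Lipschitz function. -/
def clarkeDirDeriv {p : ℕ} (φ : EuclideanSpace ℝ (Fin p) → ℝ)
    (x v : EuclideanSpace ℝ (Fin p)) : ℝ :=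
  limsup (fun ys : EuclideanSpace ℝ (Fin p) × ℝ => (φ (ys.1 + ys.2 • v) - φ ys.1) / ys.2)
    (𝓝 x ×ˢ 𝓝[>] (0 : ℝ))

/-- The Clarke subdifferential `∂°φ(x)` of a locally Lipschitz function. -/
def clarkeSubdiff {p : ℕ} (φ : EuclideanSpace ℝ (Fin p) → ℝ) (x : EuclideanSpace ℝ (Fin p)) :
    Set (EuclideanSpace ℝ (Fin p)) :=
  {ξ | ∀ v, inner ℝ ξ v ≤ clarkeDirDeriv φ x v}

/-- `φ` admits a chain rule: along every absolutely continuous arc `z`, for almost every `t`,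
`d/dt φ(z(t)) = ⟪ξ, z'(t)⟫` for all `ξ ∈ ∂°φ(z(t))`. -/
def AdmitsChainRule {p : ℕ} (φ : EuclideanSpace ℝ (Fin p) → ℝ) : Prop :=
  ∀ (a b : ℝ) (z : ℝ → EuclideanSpace ℝ (Fin p)), a < b →
    AbsolutelyContinuousOnInterval z a b →
      ∀ᵐ t ∂(volume.restrict (Set.Icc a b)), ∀ ξ ∈ clarkeSubdiff φ (z t),
        HasDerivAt (fun s => φ (z s)) (inner ℝ ξ (deriv z t)) t

/-- The continuous RMSProp conditioner `h(t)` built from a subgradient path `g`: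
`h_j(t)⁻¹ = √(ε + ∫_0^t (1 - b) e^{-(1 - b)(t - τ)} g_j(τ)² dτ)`. -/
def rmsConditioner {p : ℕ} (b ε : ℝ) (g : ℝ → EuclideanSpace ℝ (Fin p)) (t : ℝ) :
    EuclideanSpace ℝ (Fin p) :=
  WithLp.toLp 2 fun j =>
    (Real.sqrt (ε + ∫ τ in (0 : ℝ)..t,
      (1 - b) * Real.exp (-(1 - b) * (t - τ)) * (g τ j) ^ 2))⁻¹

/-- `w : [0, ∞) → ℝ^p` is an RMSProp flow of the loss `𝓛`: it is locally absolutely continuous,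
and for some measurable path `g` of subgradients, `g(t) ∈ ∂°𝓛(w(t))`, it satisfies
`w'(t) = -h(t) ⊙ g(t)` for almost every `t ≥ 0`, where `h` is the conditioner built from `g`. -/
def IsRMSPropFlow {p : ℕ} (b ε : ℝ) (𝓛 : EuclideanSpace ℝ (Fin p) → ℝ)
    (w : ℝ → EuclideanSpace ℝ (Fin p)) : Prop :=
  (∀ T : ℝ, 0 < T → AbsolutelyContinuousOnInterval w 0 T) ∧
  ∃ g : ℝ → EuclideanSpace ℝ (Fin p),
    AEStronglyMeasurable g (volume.restrict (Set.Ici (0 : ℝ))) ∧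
    ∀ᵐ t ∂(volume.restrict (Set.Ici (0 : ℝ))),
      g t ∈ clarkeSubdiff 𝓛 (w t) ∧
      HasDerivAt w (WithLp.toLp 2 fun j => -(rmsConditioner b ε g t j * g t j)) t

/-- `x` is a KKT point of `min φ(x)` subject to `c_i(x) ≤ 0` for all `i`
(with `φ` and the `c_i` locally Lipschitz). -/
def IsKKTPoint {p N : ℕ} (φ : EuclideanSpace ℝ (Fin p) → ℝ)
    (c : Fin N → EuclideanSpace ℝ (Fin p) → ℝ) (x : EuclideanSpace ℝ (Fin p)) : Prop :=
  (∀ i, c i x ≤ 0) ∧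
  ∃ (lam : Fin N → ℝ) (k : EuclideanSpace ℝ (Fin p)) (h : Fin N → EuclideanSpace ℝ (Fin p)),
    (∀ i, 0 ≤ lam i) ∧ k ∈ clarkeSubdiff φ x ∧ (∀ i, h i ∈ clarkeSubdiff (c i) x) ∧
    k + ∑ i, lam i • h i = 0 ∧ ∀ i, lam i * c i x = 0

end

/-! With a = 1 - b and m_j = h_j⁻², the flow reads w_j' = -m_j^(-1/2) g_j, m_j' = a (g_j² - (m_j -
ε)). Write D = ∑ m_j^(-1/2) g_j², ρ² = ∑ m_j^(1/2) w_j² (`condNormSq`) and ν for `marginSum`. A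
subgradient of the loss splits into subgradients of the margins by Hahn–Banach
(`exists_clarkeSubdiff_decomposition`), so the chain rule for the margins gives 𝓛' = -D, and Euler's
identity gives ⟪g, w⟫ = -Lν.

The metric moves with time, but (ρ²)' exceeds 2Lν by at most c D ρ² with c = a / (2√ε). Since D is
the rate of decrease of 𝓛, a multiple of 𝓛 absorbs this error. The corrected logarithm of the
smoothed margin (`logMargin`) then has derivative at least D/ν - L²ν/ρ², which is nonnegative by
Cauchy–Schwarz (`logMargin_mono`). Hence all margins are at least of order ‖w‖^L. If 𝓛 stayed away
from zero, ρ would be bounded and D bounded below; so 𝓛 → 0 and ‖w‖ → ∞. As D has finite integral,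
m_j → ε (`tendsto_m`), and the metric becomes √ε times the Euclidean one.

`logMargin` is also bounded above. In the clock Θ with Θ' = ν/ρ², which runs to infinity, the
direction of w is Lipschitz and the excess Dρ²/ν² - L² has finite integral. A direction close to a
limit point stays close for a clock interval of fixed length, and late intervals of this kind
contain times of small excess (`exists_aligned_time`). Small excess is near equality in
Cauchy–Schwarz: g is almost a negative multiple of the vector (√m_j w_j) (`sq_sub_le_of_aligned`).

After rescaling, √ε times the limit direction is a limit of nonnegative combinations of margin
subgradients with bounded multipliers. Closedness of the Clarke subdifferential passes to the limit;
the multipliers of nonminimal margins die out because slopes decay exponentially in margin gaps of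
order ‖w‖^L. Homogeneity finally rescales the smallest margin to one (`exists_isKKTPoint`). -/

/-! ### Clarke calculus -/

section Clarke

variable {p : ℕ}

lemma tendsto_clarke_base (x v : EuclideanSpace ℝ (Fin p)) :
    Tendsto (fun ys : EuclideanSpace ℝ (Fin p) × ℝ => ys.1 + ys.2 • v)
      (𝓝 x ×ˢ 𝓝[>] (0 : ℝ)) (𝓝 x) := by
  have h : Tendsto (fun ys : EuclideanSpace ℝ (Fin p) × ℝ => ys.1 + ys.2 • v)
      (𝓝 (x, (0 : ℝ))) (𝓝 (x + (0 : ℝ) • v)) :=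
    Continuous.tendsto (by fun_prop) (x, (0 : ℝ))
  rw [zero_smul, add_zero] at h
  refine h.mono_left ?_
  rw [nhds_prod_eq]
  exact Filter.prod_mono le_rfl nhdsWithin_le_nhds

lemma tendsto_clarke_shift (x v : EuclideanSpace ℝ (Fin p)) :
    Tendsto (fun ys : EuclideanSpace ℝ (Fin p) × ℝ => (ys.1 + ys.2 • v, ys.2))
      (𝓝 x ×ˢ 𝓝[>] (0 : ℝ)) (𝓝 x ×ˢ 𝓝[>] (0 : ℝ)) :=
  (tendsto_clarke_base x v).prodMk tendsto_snd

lemma eventually_clarke_pos (x : EuclideanSpace ℝ (Fin p)) :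
    ∀ᶠ ys : EuclideanSpace ℝ (Fin p) × ℝ in 𝓝 x ×ˢ 𝓝[>] (0 : ℝ), 0 < ys.2 :=
  tendsto_snd.eventually (eventually_mem_nhdsWithin (a := (0 : ℝ)) (s := Set.Ioi 0))

lemma LipschitzOnWith.eventually_abs_clarke_quotient_le {φ : EuclideanSpace ℝ (Fin p) → ℝ}
    {K : NNReal} {U : Set (EuclideanSpace ℝ (Fin p))} (h : LipschitzOnWith K φ U)
    {x : EuclideanSpace ℝ (Fin p)} (hU : U ∈ 𝓝 x) (v : EuclideanSpace ℝ (Fin p)) :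
    ∀ᶠ ys : EuclideanSpace ℝ (Fin p) × ℝ in 𝓝 x ×ˢ 𝓝[>] (0 : ℝ),
      |(φ (ys.1 + ys.2 • v) - φ ys.1) / ys.2| ≤ K * ‖v‖ := by
  filter_upwards [eventually_clarke_pos x, (tendsto_clarke_base x v).eventually hU,
    (tendsto_fst (f := 𝓝 x) (g := 𝓝[>] (0 : ℝ))).eventually hU] with ys hs h1 h2
  have h3 := h.dist_le_mul _ h1 _ h2
  rw [Real.dist_eq, dist_eq_norm, add_sub_cancel_left, norm_smul, Real.norm_eq_abs,
    abs_of_pos hs] at h3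
  rw [abs_div, abs_of_pos hs, div_le_iff₀ hs]
  linarith

variable {φ : EuclideanSpace ℝ (Fin p) → ℝ}

/-- The real-valued `limsup` is meaningful only for quotients that are bounded near the limit; both
bounds come from the local Lipschitz constant. -/
lemma LocallyLipschitz.clarke_bounded (hφ : LocallyLipschitz φ)
    (x v : EuclideanSpace ℝ (Fin p)) :
    IsBoundedUnder (· ≤ ·) (𝓝 x ×ˢ 𝓝[>] (0 : ℝ))
      (fun ys : EuclideanSpace ℝ (Fin p) × ℝ => (φ (ys.1 + ys.2 • v) - φ ys.1) / ys.2) ∧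
    IsCoboundedUnder (· ≤ ·) (𝓝 x ×ˢ 𝓝[>] (0 : ℝ))
      (fun ys : EuclideanSpace ℝ (Fin p) × ℝ => (φ (ys.1 + ys.2 • v) - φ ys.1) / ys.2) := by
  obtain ⟨K, U, hU, hK⟩ := hφ x
  have h := hK.eventually_abs_clarke_quotient_le hU v
  constructor
  · exact ⟨K * ‖v‖, eventually_map.2 (h.mono fun ys hy => (abs_le.1 hy).2)⟩
  · refine IsBoundedUnder.isCoboundedUnder_le ?_
    exact ⟨-(K * ‖v‖), eventually_map.2 (h.mono fun ys hy => (abs_le.1 hy).1)⟩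

lemma LocallyLipschitz.eventually_lt_of_clarkeDirDeriv_lt (hφ : LocallyLipschitz φ)
    {x v : EuclideanSpace ℝ (Fin p)} {c : ℝ} (h : clarkeDirDeriv φ x v < c) :
    ∀ᶠ ys : EuclideanSpace ℝ (Fin p) × ℝ in 𝓝 x ×ˢ 𝓝[>] (0 : ℝ),
      (φ (ys.1 + ys.2 • v) - φ ys.1) / ys.2 < c :=
  eventually_lt_of_limsup_lt h (hφ.clarke_bounded x v).1

lemma LocallyLipschitz.clarkeDirDeriv_le (hφ : LocallyLipschitz φ)
    {x v : EuclideanSpace ℝ (Fin p)} {c : ℝ}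
    (h : ∀ᶠ ys : EuclideanSpace ℝ (Fin p) × ℝ in 𝓝 x ×ˢ 𝓝[>] (0 : ℝ),
      (φ (ys.1 + ys.2 • v) - φ ys.1) / ys.2 ≤ c) :
    clarkeDirDeriv φ x v ≤ c :=
  limsup_le_of_le (hφ.clarke_bounded x v).2 h

lemma LipschitzOnWith.clarkeDirDeriv_le_mul_norm (hφ : LocallyLipschitz φ) {K : NNReal}
    {U : Set (EuclideanSpace ℝ (Fin p))} (h : LipschitzOnWith K φ U)
    {x : EuclideanSpace ℝ (Fin p)} (hU : U ∈ 𝓝 x) (v : EuclideanSpace ℝ (Fin p)) :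
    clarkeDirDeriv φ x v ≤ K * ‖v‖ :=
  hφ.clarkeDirDeriv_le ((h.eventually_abs_clarke_quotient_le hU v).mono
    fun _ hy => (abs_le.1 hy).2)

/-- The increment is split at y + s v. This moves the base point of the first piece, which is
harmless because the base point is free to vary in the `limsup`. -/
lemma LocallyLipschitz.clarkeDirDeriv_add_le (hφ : LocallyLipschitz φ)
    (x u v : EuclideanSpace ℝ (Fin p)) :
    clarkeDirDeriv φ x (u + v) ≤ clarkeDirDeriv φ x u + clarkeDirDeriv φ x v := by
  refine le_of_forall_pos_le_add fun δ hδ => ?_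
  refine hφ.clarkeDirDeriv_le ?_
  have h1 := hφ.eventually_lt_of_clarkeDirDeriv_lt (x := x) (v := u)
    (c := clarkeDirDeriv φ x u + δ / 2) (by linarith)
  have h2 := hφ.eventually_lt_of_clarkeDirDeriv_lt (x := x) (v := v)
    (c := clarkeDirDeriv φ x v + δ / 2) (by linarith)
  filter_upwards [(tendsto_clarke_shift x v).eventually h1, h2] with ys a1 a2
  have e : ys.1 + ys.2 • (u + v) = ys.1 + ys.2 • v + ys.2 • u := by
    rw [smul_add]; abel
  rw [e]
  have : (φ (ys.1 + ys.2 • v + ys.2 • u) - φ ys.1) / ys.2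
      = (φ (ys.1 + ys.2 • v + ys.2 • u) - φ (ys.1 + ys.2 • v)) / ys.2
        + (φ (ys.1 + ys.2 • v) - φ ys.1) / ys.2 := by ring
  rw [this]
  linarith

lemma LocallyLipschitz.clarkeDirDeriv_smul_le (hφ : LocallyLipschitz φ)
    (x v : EuclideanSpace ℝ (Fin p)) {c : ℝ} (hc : 0 < c) :
    clarkeDirDeriv φ x (c • v) ≤ c * clarkeDirDeriv φ x v := by
  refine le_of_forall_pos_le_add fun δ hδ => ?_
  refine hφ.clarkeDirDeriv_le ?_
  have h1 := hφ.eventually_lt_of_clarkeDirDeriv_lt (x := x) (v := v)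
    (c := clarkeDirDeriv φ x v + δ / c) (by have := div_pos hδ hc; linarith)
  have ht : Tendsto (fun ys : EuclideanSpace ℝ (Fin p) × ℝ => (ys.1, ys.2 * c))
      (𝓝 x ×ˢ 𝓝[>] (0 : ℝ)) (𝓝 x ×ˢ 𝓝[>] (0 : ℝ)) := by
    refine tendsto_fst.prodMk ?_
    refine tendsto_nhdsWithin_iff.2 ⟨?_, ?_⟩
    · have h0 : Tendsto (fun ys : EuclideanSpace ℝ (Fin p) × ℝ => ys.2)
          (𝓝 x ×ˢ 𝓝[>] (0 : ℝ)) (𝓝 0) := tendsto_snd.mono_right nhdsWithin_le_nhds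
      simpa using h0.mul_const c
    · filter_upwards [eventually_clarke_pos x] with ys hs
      exact mul_pos hs hc
  filter_upwards [ht.eventually h1, eventually_clarke_pos x] with ys a1 hs
  rw [smul_smul]
  have e : (φ (ys.1 + (ys.2 * c) • v) - φ ys.1) / ys.2
      = c * ((φ (ys.1 + (ys.2 * c) • v) - φ ys.1) / (ys.2 * c)) := by
    field_simp
  rw [e]
  calc _ ≤ c * (clarkeDirDeriv φ x v + δ / c) := by gcongr
    _ = _ := by field_simp

lemma LocallyLipschitz.clarkeDirDeriv_smul (hφ : LocallyLipschitz φ)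
    (x v : EuclideanSpace ℝ (Fin p)) {c : ℝ} (hc : 0 < c) :
    clarkeDirDeriv φ x (c • v) = c * clarkeDirDeriv φ x v := by
  refine le_antisymm (hφ.clarkeDirDeriv_smul_le x v hc) ?_
  have h := hφ.clarkeDirDeriv_smul_le x (c • v) (inv_pos.2 hc)
  rw [inv_smul_smul₀ hc.ne'] at h
  calc c * clarkeDirDeriv φ x v ≤ c * (c⁻¹ * clarkeDirDeriv φ x (c • v)) := by gcongr
    _ = _ := by field_simp

lemma LocallyLipschitz.clarkeDirDeriv_zero (hφ : LocallyLipschitz φ)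
    (x : EuclideanSpace ℝ (Fin p)) : clarkeDirDeriv φ x 0 = 0 := by
  have h := hφ.clarkeDirDeriv_smul x 0 (c := 2) two_pos
  rw [smul_zero] at h
  linarith

lemma LipschitzOnWith.norm_le_of_mem_clarkeSubdiff (hφ : LocallyLipschitz φ) {K : NNReal}
    {U : Set (EuclideanSpace ℝ (Fin p))} (h : LipschitzOnWith K φ U)
    {x : EuclideanSpace ℝ (Fin p)} (hU : U ∈ 𝓝 x) {ξ : EuclideanSpace ℝ (Fin p)}
    (hξ : ξ ∈ clarkeSubdiff φ x) : ‖ξ‖ ≤ K := by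
  have h1 := (hξ ξ).trans (h.clarkeDirDeriv_le_mul_norm hφ hU ξ)
  rw [real_inner_self_eq_norm_mul_norm] at h1
  by_contra hlt
  push Not at hlt
  have : 0 < ‖ξ‖ := lt_of_le_of_lt K.2 hlt
  nlinarith

lemma LocallyLipschitz.exists_norm_clarkeSubdiff_le (hφ : LocallyLipschitz φ)
    {S : Set (EuclideanSpace ℝ (Fin p))} (hS : IsCompact S) :
    ∃ C : ℝ, 0 ≤ C ∧ ∀ x ∈ S, ∀ ξ ∈ clarkeSubdiff φ x, ‖ξ‖ ≤ C := by
  refine hS.induction_on (p := fun S => ∃ C : ℝ, 0 ≤ C ∧ ∀ x ∈ S, ∀ ξ ∈ clarkeSubdiff φ x, ‖ξ‖ ≤ C)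
    ⟨0, le_rfl, by simp⟩ ?_ ?_ ?_
  · rintro s t hst ⟨C, hC, h⟩
    exact ⟨C, hC, fun x hx => h x (hst hx)⟩
  · rintro s t ⟨C, hC, h⟩ ⟨D, hD, h'⟩
    refine ⟨max C D, le_max_of_le_left hC, ?_⟩
    rintro x (hx | hx) ξ hξ
    · exact (h x hx ξ hξ).trans (le_max_left _ _)
    · exact (h' x hx ξ hξ).trans (le_max_right _ _)
  · intro x _
    obtain ⟨K, U, hU, hK⟩ := hφ x
    refine ⟨interior U, mem_nhdsWithin_of_mem_nhds (interior_mem_nhds.2 hU), K, K.2, ?_⟩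
    intro y hy ξ hξ
    exact hK.norm_le_of_mem_clarkeSubdiff hφ (mem_interior_iff_mem_nhds.1 hy) hξ

/-- For fixed v the generalized derivative is upper semicontinuous in the base point: a bound on the
quotients valid for all base points near x₀ is valid near every nearby point too. -/
lemma LocallyLipschitz.mem_clarkeSubdiff_of_tendsto (hφ : LocallyLipschitz φ) {ι : Type*}
    {l : Filter ι} [l.NeBot] {x ξ : ι → EuclideanSpace ℝ (Fin p)}
    {x₀ ξ₀ : EuclideanSpace ℝ (Fin p)} (hx : Tendsto x l (𝓝 x₀)) (hξ : Tendsto ξ l (𝓝 ξ₀))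
    (h : ∀ᶠ n in l, ξ n ∈ clarkeSubdiff φ (x n)) : ξ₀ ∈ clarkeSubdiff φ x₀ := by
  intro v
  refine le_of_forall_pos_le_add fun δ hδ => ?_
  have h1 := hφ.eventually_lt_of_clarkeDirDeriv_lt (x := x₀) (v := v)
    (c := clarkeDirDeriv φ x₀ v + δ) (by linarith)
  obtain ⟨P, hP, R, hR, hPR⟩ := eventually_prod_iff.1 h1
  have h2 : ∀ᶠ y in 𝓝 x₀, clarkeDirDeriv φ y v ≤ clarkeDirDeriv φ x₀ v + δ := by
    filter_upwards [eventually_eventually_nhds.2 hP] with y hy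
    refine hφ.clarkeDirDeriv_le ?_
    exact eventually_prod_iff.2 ⟨P, hy, R, hR, fun hp _ hr => (hPR hp hr).le⟩
  refine le_of_tendsto (hξ.inner tendsto_const_nhds) ?_
  filter_upwards [h, hx.eventually h2] with n a1 a2
  exact (a1 v).trans a2

/-- Strict differentiability is what a moving base point requires; the quotients then converge, and
their `limsup` is a limit. -/
lemma HasStrictFDerivAt.clarkeDirDeriv_eq {x : EuclideanSpace ℝ (Fin p)}
    {φ' : EuclideanSpace ℝ (Fin p) →L[ℝ] ℝ} (h : HasStrictFDerivAt φ φ' x)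
    (v : EuclideanSpace ℝ (Fin p)) : clarkeDirDeriv φ x v = φ' v := by
  refine Tendsto.limsup_eq ?_
  have h1 := h.isLittleO.comp_tendsto
    ((tendsto_clarke_base x v).prodMk_nhds (tendsto_fst (f := 𝓝 x) (g := 𝓝[>] (0 : ℝ))))
  have h2 : (fun ys : EuclideanSpace ℝ (Fin p) × ℝ =>
      φ (ys.1 + ys.2 • v) - φ ys.1 - ys.2 * φ' v) =o[𝓝 x ×ˢ 𝓝[>] (0 : ℝ)]
      (fun ys => ys.2) := by
    have h3 : (fun ys : EuclideanSpace ℝ (Fin p) × ℝ => ys.2 • v)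
        =O[𝓝 x ×ˢ 𝓝[>] (0 : ℝ)] (fun ys => ys.2) := by
      refine Asymptotics.IsBigO.of_bound ‖v‖ (Eventually.of_forall fun ys => ?_)
      rw [norm_smul, mul_comm]
    simp only [Function.comp_def, add_sub_cancel_left, map_smul, smul_eq_mul] at h1
    exact h1.trans_isBigO h3
  have h4 := h2.tendsto_div_nhds_zero.add_const (φ' v)
  rw [zero_add] at h4
  refine h4.congr' ?_
  filter_upwards [eventually_clarke_pos x] with ys hs
  field_simp
  ring

lemma HasStrictFDerivAt.mem_clarkeSubdiff {x ξ : EuclideanSpace ℝ (Fin p)}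
    (h : HasStrictFDerivAt φ (innerSL ℝ ξ) x) : ξ ∈ clarkeSubdiff φ x := by
  intro v
  rw [h.clarkeDirDeriv_eq v, innerSL_apply_apply]

/-- Moving the base point from y to y - s v turns a quotient of φ in direction -v into one of c - φ
in direction v. It converts margin subgradients into constraint subgradients. -/
lemma LocallyLipschitz.neg_mem_clarkeSubdiff_const_sub (hφ : LocallyLipschitz φ) (c : ℝ)
    {x ξ : EuclideanSpace ℝ (Fin p)} (hξ : ξ ∈ clarkeSubdiff φ x) :
    -ξ ∈ clarkeSubdiff (fun u => c - φ u) x := by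
  have hψ : LocallyLipschitz (fun u => c - φ u) := by
    intro y
    obtain ⟨K, U, hU, hK⟩ := hφ y
    refine ⟨K, U, hU, ?_⟩
    refine LipschitzOnWith.of_dist_le_mul fun a ha b hb => ?_
    rw [dist_sub_left]
    exact hK.dist_le_mul a ha b hb
  intro v
  have h1 := hξ (-v)
  rw [inner_neg_left]
  rw [inner_neg_right] at h1
  refine h1.trans ?_
  refine le_of_forall_pos_le_add fun δ hδ => ?_
  refine hφ.clarkeDirDeriv_le ?_
  have h2 := hψ.eventually_lt_of_clarkeDirDeriv_lt (x := x) (v := v)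
    (c := clarkeDirDeriv (fun u => c - φ u) x v + δ) (by linarith)
  filter_upwards [(tendsto_clarke_shift x (-v)).eventually h2] with ys a
  have e : ys.1 + ys.2 • -v + ys.2 • v = ys.1 := by simp
  rw [e] at a
  have : c - φ ys.1 - (c - φ (ys.1 + ys.2 • -v)) = φ (ys.1 + ys.2 • -v) - φ ys.1 := by ring
  rw [this] at a
  exact a.le

/-! ### Homogeneous functions -/

/-- The substitution (y, s) ↦ (α y, α s) multiplies the quotient by α^L / α. -/
lemma clarkeDirDeriv_smul_of_homogeneous (hφ : LocallyLipschitz φ) {L : ℝ}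
    (hL : ∀ (α : ℝ) (u : EuclideanSpace ℝ (Fin p)), 0 < α → φ (α • u) = α ^ L * φ u)
    (x v : EuclideanSpace ℝ (Fin p)) {α : ℝ} (hα : 0 < α) :
    α ^ (L - 1) * clarkeDirDeriv φ x v ≤ clarkeDirDeriv φ (α • x) v := by
  have hp : 0 < α ^ (L - 1) := Real.rpow_pos_of_pos hα _
  rw [← le_div_iff₀' hp]
  refine le_of_forall_pos_le_add fun δ hδ => ?_
  refine hφ.clarkeDirDeriv_le ?_
  have h1 := hφ.eventually_lt_of_clarkeDirDeriv_lt (x := α • x) (v := v)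
    (c := clarkeDirDeriv φ (α • x) v + δ * α ^ (L - 1)) (by have := mul_pos hδ hp; linarith)
  have ht : Tendsto (fun ys : EuclideanSpace ℝ (Fin p) × ℝ => (α • ys.1, α * ys.2))
      (𝓝 x ×ˢ 𝓝[>] (0 : ℝ)) (𝓝 (α • x) ×ˢ 𝓝[>] (0 : ℝ)) := by
    refine (tendsto_fst.const_smul α).prodMk ?_
    refine tendsto_nhdsWithin_iff.2 ⟨?_, ?_⟩
    · have h0 : Tendsto (fun ys : EuclideanSpace ℝ (Fin p) × ℝ => ys.2)
          (𝓝 x ×ˢ 𝓝[>] (0 : ℝ)) (𝓝 0) := tendsto_snd.mono_right nhdsWithin_le_nhds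
      simpa using h0.const_mul α
    · filter_upwards [eventually_clarke_pos x] with ys hs
      exact mul_pos hα hs
  filter_upwards [ht.eventually h1, eventually_clarke_pos x] with ys a hs
  rw [mul_smul, ← smul_add, hL _ _ hα, hL _ _ hα] at a
  have e : α ^ L = α ^ (L - 1) * α := by
    rw [← Real.rpow_add_one hα.ne', sub_add_cancel]
  have e2 : (α ^ L * φ (ys.1 + ys.2 • v) - α ^ L * φ ys.1) / (α * ys.2)
      = α ^ (L - 1) * ((φ (ys.1 + ys.2 • v) - φ ys.1) / ys.2) := by
    rw [e]; field_simp
  rw [e2] at a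
  have e3 : clarkeDirDeriv φ (α • x) v / α ^ (L - 1) + δ
      = (clarkeDirDeriv φ (α • x) v + δ * α ^ (L - 1)) / α ^ (L - 1) := by
    field_simp
  rw [e3, le_div_iff₀' hp]
  exact a.le

lemma smul_mem_clarkeSubdiff_of_homogeneous (hφ : LocallyLipschitz φ) {L : ℝ}
    (hL : ∀ (α : ℝ) (u : EuclideanSpace ℝ (Fin p)), 0 < α → φ (α • u) = α ^ L * φ u)
    {x ξ : EuclideanSpace ℝ (Fin p)} (hξ : ξ ∈ clarkeSubdiff φ x) {α : ℝ} (hα : 0 < α) :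
    α ^ (L - 1) • ξ ∈ clarkeSubdiff φ (α • x) := by
  intro v
  rw [real_inner_smul_left]
  refine le_trans ?_ (clarkeDirDeriv_smul_of_homogeneous hφ hL x v hα)
  have := Real.rpow_pos_of_pos hα (L - 1)
  gcongr
  exact hξ v

/-- The sign of σ is left free because σ = 1 and σ = -1 supply the two inequalities of Euler's
identity. -/
lemma clarkeDirDeriv_self_le_of_homogeneous (hφ : LocallyLipschitz φ) {L : ℝ}
    (hL : ∀ (α : ℝ) (u : EuclideanSpace ℝ (Fin p)), 0 < α → φ (α • u) = α ^ L * φ u)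
    (x : EuclideanSpace ℝ (Fin p)) (σ : ℝ) :
    clarkeDirDeriv φ x (σ • x) ≤ σ * (L * φ x) := by
  obtain ⟨K, U, hU, hK⟩ := hφ x
  -- compare `φ (y + s σ x)` with `φ ((1 + s σ) y)`
  have t1 : Tendsto (fun ys : EuclideanSpace ℝ (Fin p) × ℝ => (1 + ys.2 * σ) • ys.1)
      (𝓝 x ×ˢ 𝓝[>] (0 : ℝ)) (𝓝 x) := by
    have h : Tendsto (fun ys : EuclideanSpace ℝ (Fin p) × ℝ => (1 + ys.2 * σ) • ys.1)
        (𝓝 (x, (0 : ℝ))) (𝓝 ((1 + (0 : ℝ) * σ) • x)) :=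
      Continuous.tendsto (by fun_prop) (x, (0 : ℝ))
    rw [zero_mul, add_zero, one_smul] at h
    refine h.mono_left ?_
    rw [nhds_prod_eq]
    exact Filter.prod_mono le_rfl nhdsWithin_le_nhds
  have t2 : Tendsto (fun s : ℝ => ((1 + s * σ) ^ L - 1) / s) (𝓝[>] 0) (𝓝 (σ * L)) := by
    have hd : HasDerivAt (fun s : ℝ => (1 + s * σ) ^ L) (σ * L) 0 := by
      have := ((hasDerivAt_id (0 : ℝ)).mul_const σ).const_add 1
      have := this.rpow_const (p := L) (Or.inl (by simp))
      simpa using this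
    have h := hd.tendsto_slope_zero_right
    simp only [zero_add, zero_mul, add_zero, Real.one_rpow, smul_eq_mul] at h
    refine h.congr fun s => ?_
    ring
  -- The second summand is the Lipschitz cost of replacing y + sσx by (1 + sσ)y, whose difference is
  -- sσ(x - y); divided by s it vanishes as y → x.
  have t3 : Tendsto (fun ys : EuclideanSpace ℝ (Fin p) × ℝ =>
      ((1 + ys.2 * σ) ^ L - 1) / ys.2 * φ ys.1 + K * |σ| * ‖x - ys.1‖)
      (𝓝 x ×ˢ 𝓝[>] (0 : ℝ)) (𝓝 (σ * L * φ x + K * |σ| * ‖x - x‖)) := by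
    have hf : Tendsto (fun ys : EuclideanSpace ℝ (Fin p) × ℝ => ys.1)
        (𝓝 x ×ˢ 𝓝[>] (0 : ℝ)) (𝓝 x) := tendsto_fst
    refine ((t2.comp tendsto_snd).mul ((hφ.continuous.tendsto x).comp hf)).add ?_
    exact (tendsto_const_nhds.sub hf).norm.const_mul _
  rw [sub_self, norm_zero, mul_zero, add_zero] at t3
  refine le_of_forall_pos_le_add fun δ hδ => ?_
  refine hφ.clarkeDirDeriv_le ?_
  have t4 : ∀ᶠ ys : EuclideanSpace ℝ (Fin p) × ℝ in 𝓝 x ×ˢ 𝓝[>] (0 : ℝ), 0 < 1 + ys.2 * σ := by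
    have h0 : Tendsto (fun ys : EuclideanSpace ℝ (Fin p) × ℝ => 1 + ys.2 * σ)
        (𝓝 x ×ˢ 𝓝[>] (0 : ℝ)) (𝓝 (1 + 0 * σ)) :=
      ((tendsto_snd.mono_right nhdsWithin_le_nhds).mul_const σ).const_add 1
    exact h0.eventually (lt_mem_nhds (by simp))
  filter_upwards [eventually_clarke_pos x, t1.eventually hU,
    (tendsto_clarke_base x (σ • x)).eventually hU, t4,
    t3.eventually (gt_mem_nhds (show σ * L * φ x < σ * (L * φ x) + δ by linarith))]
    with ys hs h1 h2 h4 h3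
  have h5 := hK.dist_le_mul _ h2 _ h1
  have e : ys.1 + ys.2 • σ • x - (1 + ys.2 * σ) • ys.1 = (ys.2 * σ) • (x - ys.1) := by
    rw [smul_smul]; module
  rw [Real.dist_eq, dist_eq_norm, e, norm_smul, Real.norm_eq_abs, abs_mul, abs_of_pos hs,
    hL _ _ h4] at h5
  have h6 := (abs_le.1 h5).2
  refine le_trans ?_ h3.le
  rw [div_le_iff₀ hs, add_mul]
  have e2 : ((1 + ys.2 * σ) ^ L - 1) / ys.2 * φ ys.1 * ys.2
      = (1 + ys.2 * σ) ^ L * φ ys.1 - φ ys.1 := by field_simp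
  rw [e2]
  linarith

/-- Euler's identity for Clarke subgradients of a homogeneous function. -/
lemma inner_self_of_mem_clarkeSubdiff_of_homogeneous (hφ : LocallyLipschitz φ) {L : ℝ}
    (hL : ∀ (α : ℝ) (u : EuclideanSpace ℝ (Fin p)), 0 < α → φ (α • u) = α ^ L * φ u)
    {x ξ : EuclideanSpace ℝ (Fin p)} (hξ : ξ ∈ clarkeSubdiff φ x) :
    inner ℝ ξ x = L * φ x := by
  have h1 := (hξ _).trans (clarkeDirDeriv_self_le_of_homogeneous hφ hL x 1)
  have h2 := (hξ _).trans (clarkeDirDeriv_self_le_of_homogeneous hφ hL x (-1))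
  rw [real_inner_smul_right] at h1 h2
  linarith

end Clarke

/-! ### Sum and chain rules for Clarke subdifferentials -/

section ClarkeSum

variable {p : ℕ}

lemma LocallyLipschitz.finset_sum_real {X ι : Type*} [PseudoEMetricSpace X] (s : Finset ι)
    {F : ι → X → ℝ} (h : ∀ i, LocallyLipschitz (F i)) :
    LocallyLipschitz (fun x => ∑ i ∈ s, F i x) := by
  classical
  induction s using Finset.induction_on with
  | empty => simpa using LocallyLipschitz.const (0 : ℝ)
  | insert i s hi ih =>
    simp only [Finset.sum_insert hi]
    exact (h i).add ih

/-- Since σ decreases, an increment of σ ∘ q i along v is, to first order, a i times the increment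
of q i traversed backwards, whence the direction -v. -/
lemma clarkeDirDeriv_sum_comp_le {N : ℕ} {q : Fin N → EuclideanSpace ℝ (Fin p) → ℝ}
    (hq : ∀ i, LocallyLipschitz (q i)) {σ : ℝ → ℝ} (hσ : LocallyLipschitz σ)
    {x : EuclideanSpace ℝ (Fin p)} {a : Fin N → ℝ} (ha : ∀ i, 0 < a i)
    (hd : ∀ i, HasStrictDerivAt σ (-a i) (q i x)) (v : EuclideanSpace ℝ (Fin p)) :
    clarkeDirDeriv (fun u => ∑ i, σ (q i u)) x v ≤ ∑ i, a i * clarkeDirDeriv (q i) x (-v) := by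
  have hLip : LocallyLipschitz (fun u => ∑ i, σ (q i u)) :=
    LocallyLipschitz.finset_sum_real _ fun i => hσ.comp (hq i)
  have key : ∀ i, ∀ δ > (0 : ℝ), ∀ᶠ ys : EuclideanSpace ℝ (Fin p) × ℝ in 𝓝 x ×ˢ 𝓝[>] (0 : ℝ),
      (σ (q i (ys.1 + ys.2 • v)) - σ (q i ys.1)) / ys.2
        ≤ a i * clarkeDirDeriv (q i) x (-v) + δ := by
    intro i δ hδ
    obtain ⟨K, U, hU, hK⟩ := hq i x
    have hdiv : 0 < δ / 2 / a i := div_pos (half_pos hδ) (ha i)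
    have h1 := (hq i).eventually_lt_of_clarkeDirDeriv_lt (x := x) (v := -v)
      (c := clarkeDirDeriv (q i) x (-v) + δ / 2 / a i) (by linarith)
    have hden : 0 < K * ‖v‖ + 1 := by positivity
    have hc : 0 < δ / 2 / (K * ‖v‖ + 1) := div_pos (half_pos hδ) hden
    have hqc := (hq i).continuous.tendsto x
    have h2 := (((hd i).hasStrictFDerivAt.isLittleO.comp_tendsto
      ((hqc.comp (tendsto_clarke_base x v)).prodMk_nhds
        (hqc.comp (tendsto_fst (f := 𝓝 x) (g := 𝓝[>] (0 : ℝ))))))).bound hc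
    filter_upwards [(tendsto_clarke_shift x v).eventually h1, h2,
      hK.eventually_abs_clarke_quotient_le hU v, eventually_clarke_pos x] with ys a1 a2 a3 hs
    have e : ys.1 + ys.2 • v + ys.2 • -v = ys.1 := by simp
    rw [e] at a1
    simp only [Function.comp_def, ContinuousLinearMap.toSpanSingleton_apply, smul_eq_mul,
      Real.norm_eq_abs] at a2
    rw [abs_div, abs_of_pos hs, div_le_iff₀ hs] at a3
    set A := q i (ys.1 + ys.2 • v)
    set B := q i ys.1
    have a4 := (abs_le.1 a2).2
    have a5 : δ / 2 / (K * ‖v‖ + 1) * |A - B| ≤ δ / 2 * ys.2 := by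
      calc δ / 2 / (K * ‖v‖ + 1) * |A - B|
          ≤ δ / 2 / (K * ‖v‖ + 1) * ((K * ‖v‖ + 1) * ys.2) := by
            gcongr; linarith
        _ = δ / 2 * ys.2 := by field_simp
    rw [div_lt_iff₀ hs] at a1
    have a6 := mul_le_mul_of_nonneg_left a1.le (ha i).le
    have e3 : a i * ((clarkeDirDeriv (q i) x (-v) + δ / 2 / a i) * ys.2)
        = (a i * clarkeDirDeriv (q i) x (-v) + δ / 2) * ys.2 := by
      have := (ha i).ne'
      field_simp
    rw [e3] at a6
    rw [div_le_iff₀ hs]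
    nlinarith
  refine le_of_forall_pos_le_add fun δ hδ => ?_
  refine hLip.clarkeDirDeriv_le ?_
  have hall := eventually_all.2 fun i => key i (δ / (N + 1)) (by positivity)
  filter_upwards [hall] with ys h
  rw [← Finset.sum_sub_distrib, Finset.sum_div]
  calc _ ≤ ∑ i, (a i * clarkeDirDeriv (q i) x (-v) + δ / (N + 1)) :=
        Finset.sum_le_sum fun i _ => h i
    _ = ∑ i, a i * clarkeDirDeriv (q i) x (-v) + N * (δ / (N + 1)) := by
        rw [Finset.sum_add_distrib]; simp
    _ ≤ _ := by
        gcongr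
        rw [mul_div_assoc', div_le_iff₀ (by positivity)]
        nlinarith

/-- Sum and chain rule: a Clarke subgradient of `∑ i, σ (q i)` with `σ` strictly decreasing
to first order at the values `q i x` is a combination of Clarke subgradients of the `q i`. -/
lemma exists_clarkeSubdiff_decomposition {N : ℕ} (hN : 0 < N)
    {q : Fin N → EuclideanSpace ℝ (Fin p) → ℝ}
    (hq : ∀ i, LocallyLipschitz (q i)) {σ : ℝ → ℝ} (hσ : LocallyLipschitz σ)
    {x : EuclideanSpace ℝ (Fin p)} {a : Fin N → ℝ} (ha : ∀ i, 0 < a i)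
    (hd : ∀ i, HasStrictDerivAt σ (-a i) (q i x)) {ξ : EuclideanSpace ℝ (Fin p)}
    (hξ : ξ ∈ clarkeSubdiff (fun u => ∑ i, σ (q i u)) x) :
    ∃ η : Fin N → EuclideanSpace ℝ (Fin p), (∀ i, η i ∈ clarkeSubdiff (q i) x) ∧
      ξ = -∑ i, a i • η i := by
  classical
  let i₀ : Fin N := ⟨0, hN⟩
  let P : (Fin N → EuclideanSpace ℝ (Fin p)) → ℝ :=
    fun u => ∑ i, a i * clarkeDirDeriv (q i) x (u i)
  let S : Submodule ℝ (Fin N → EuclideanSpace ℝ (Fin p)) :=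
    LinearMap.range (LinearMap.pi fun _ : Fin N =>
      (LinearMap.id : EuclideanSpace ℝ (Fin p) →ₗ[ℝ] EuclideanSpace ℝ (Fin p)))
  let F : (Fin N → EuclideanSpace ℝ (Fin p)) →ₗ[ℝ] ℝ :=
    (-(innerSL ℝ ξ).toLinearMap).comp (LinearMap.proj i₀)
  have hF : ∀ u, F u = -inner ℝ ξ (u i₀) := fun u => rfl
  -- Hahn–Banach on the diagonal: the functional -⟪ξ, v⟫ on (v, …, v) is dominated by the sublinear
  -- `P`. The extension to the full product splits into one functional per coordinate, each
  -- dominated by its own summand.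
  obtain ⟨G, hG1, hG2⟩ := exists_extension_of_le_sublinear ⟨S, F.domRestrict S⟩ P
    (by
      intro c hc u
      simp only [P, Pi.smul_apply, Finset.mul_sum]
      refine Finset.sum_congr rfl fun i _ => ?_
      rw [(hq i).clarkeDirDeriv_smul x (u i) hc]; ring)
    (by
      intro u v
      simp only [P, Pi.add_apply, ← Finset.sum_add_distrib, ← mul_add]
      exact Finset.sum_le_sum fun i _ =>
        mul_le_mul_of_nonneg_left ((hq i).clarkeDirDeriv_add_le x (u i) (v i)) (ha i).le)
    (by
      rintro ⟨u, v, rfl⟩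
      change F _ ≤ _
      rw [hF]
      have h1 := (hξ (-v)).trans (clarkeDirDeriv_sum_comp_le hq hσ ha hd (-v))
      simp only [inner_neg_right, neg_neg] at h1
      simpa [P] using h1)
  have hdiag : ∀ v : EuclideanSpace ℝ (Fin p), G (fun _ => v) = -inner ℝ ξ v := fun v =>
    hG1 ⟨fun _ => v, v, rfl⟩
  let η' : Fin N → EuclideanSpace ℝ (Fin p) := fun i =>
    (InnerProductSpace.toDual ℝ (EuclideanSpace ℝ (Fin p))).symm
      (LinearMap.toContinuousLinearMap
        (G.comp (LinearMap.single ℝ (fun _ : Fin N => EuclideanSpace ℝ (Fin p)) i)))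
  have hη' : ∀ i v, inner ℝ (η' i) v = G (Pi.single i v) := by
    intro i v
    simp [η']
  refine ⟨fun i => (a i)⁻¹ • η' i, fun i v => ?_, ?_⟩
  · rw [real_inner_smul_left, hη', inv_mul_le_iff₀ (ha i)]
    refine (hG2 _).trans (le_of_eq ?_)
    simp only [P]
    rw [Finset.sum_eq_single i]
    · simp
    · intro j _ hj
      rw [Pi.single_eq_of_ne hj, (hq j).clarkeDirDeriv_zero, mul_zero]
    · simp
  · have h1 : ∑ i, a i • (a i)⁻¹ • η' i = ∑ i, η' i :=
      Finset.sum_congr rfl fun i _ => smul_inv_smul₀ (ha i).ne' _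
    rw [h1]
    refine ext_inner_right ℝ fun v => ?_
    rw [inner_neg_left, sum_inner]
    have h2 : ∑ i, inner ℝ (η' i) v = G (fun _ => v) := by
      simp only [hη', ← map_sum]
      congr 1
      exact Finset.univ_sum_single (fun _ : Fin N => v)
    rw [h2, hdiag, neg_neg]

end ClarkeSum

/-! ### The loss functions -/

namespace LossKind

/-- The individual loss `e^{-f}`. -/
noncomputable def loss (ℓ : LossKind) (x : ℝ) : ℝ := Real.exp (-(ℓ.f x))

/-- The negative derivative of the individual loss. -/
noncomputable def slope : LossKind → ℝ → ℝ
  | .exponential => fun x => Real.exp (-x)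
  | .logistic => fun x => Real.exp (-x) / (1 + Real.exp (-x))

/-- The inverse function of the individual loss on `(0, ∞)`. -/
noncomputable def lossInv : LossKind → ℝ → ℝ
  | .exponential => fun l => -Real.log l
  | .logistic => fun l => -Real.log (Real.exp l - 1)

lemma loss_exponential (x : ℝ) : loss .exponential x = Real.exp (-x) := rfl

lemma loss_logistic (x : ℝ) : loss .logistic x = Real.log (1 + Real.exp (-x)) := by
  have : 0 < Real.log (1 + Real.exp (-x)) := Real.log_pos (by linarith [Real.exp_pos (-x)])
  simp [loss, f, Real.exp_log this]

variable (ℓ : LossKind)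

lemma loss_pos (x : ℝ) : 0 < ℓ.loss x := Real.exp_pos _

lemma slope_pos (x : ℝ) : 0 < ℓ.slope x := by
  cases ℓ <;> simp only [slope] <;> positivity

lemma hasStrictDerivAt_loss (x : ℝ) : HasStrictDerivAt ℓ.loss (-ℓ.slope x) x := by
  have h1 : HasStrictDerivAt (fun y : ℝ => Real.exp (-y)) (-Real.exp (-x)) x := by
    simpa using (hasStrictDerivAt_id x).neg.exp
  cases ℓ with
  | exponential => exact h1
  | logistic =>
    have e : loss .logistic = fun y => Real.log (1 + Real.exp (-y)) := funext loss_logistic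
    rw [e]
    have := (h1.const_add 1).log (by positivity)
    simpa [slope, neg_div] using this

lemma hasDerivAt_loss (x : ℝ) : HasDerivAt ℓ.loss (-ℓ.slope x) x :=
  (ℓ.hasStrictDerivAt_loss x).hasDerivAt

lemma continuous_slope : Continuous ℓ.slope := by
  cases ℓ with
  | exponential => simp only [slope]; fun_prop
  | logistic =>
    simp only [slope]
    exact Continuous.div (by fun_prop) (by fun_prop) fun x => by positivity

lemma contDiff_loss : ContDiff ℝ 1 ℓ.loss := by
  refine contDiff_one_iff_deriv.2 ⟨fun x => (ℓ.hasDerivAt_loss x).differentiableAt, ?_⟩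
  have : deriv ℓ.loss = fun x => -ℓ.slope x := funext fun x => (ℓ.hasDerivAt_loss x).deriv
  rw [this]
  exact ℓ.continuous_slope.neg

lemma locallyLipschitz_loss : LocallyLipschitz ℓ.loss := ℓ.contDiff_loss.locallyLipschitz

lemma loss_strictAnti : StrictAnti ℓ.loss :=
  strictAnti_of_deriv_neg fun x => by
    rw [(ℓ.hasDerivAt_loss x).deriv]; linarith [ℓ.slope_pos x]

lemma slope_antitone : Antitone ℓ.slope := by
  intro x y hxy
  have h : Real.exp (-y) ≤ Real.exp (-x) := by gcongr
  cases ℓ with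
  | exponential => exact h
  | logistic =>
    simp only [slope]
    rw [div_le_div_iff₀ (by positivity) (by positivity)]
    nlinarith

/-- The factor 2 pays for the logistic denominator, 1 + e^(-y) ≤ 2 when y ≥ 0. This is the source of
complementary slackness in the limit. -/
lemma slope_le (x : ℝ) {y : ℝ} (hy : 0 ≤ y) :
    ℓ.slope x ≤ 2 * Real.exp (-(x - y)) * ℓ.slope y := by
  have e : Real.exp (-x) = Real.exp (-(x - y)) * Real.exp (-y) := by
    rw [← Real.exp_add]; ring_nf
  cases ℓ with
  | exponential =>
    simp only [slope]
    rw [e]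
    have : 0 < Real.exp (-(x - y)) * Real.exp (-y) := by positivity
    linarith
  | logistic =>
    simp only [slope]
    have h1 : Real.exp (-y) ≤ 1 := Real.exp_le_one_iff.2 (by linarith)
    calc Real.exp (-x) / (1 + Real.exp (-x)) ≤ Real.exp (-x) / 1 := by
          gcongr; linarith [Real.exp_pos (-x)]
      _ = 2 * Real.exp (-(x - y)) * (Real.exp (-y) / 2) := by rw [e]; ring
      _ ≤ _ := by gcongr; linarith

/-- This is monotonicity of f' = slope / loss, written without division. In the logistic case the
variable is r = e^(-x). -/
lemma slope_mul_loss_le {x y : ℝ} (hxy : x ≤ y) :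
    ℓ.slope x * ℓ.loss y ≤ ℓ.slope y * ℓ.loss x := by
  cases ℓ with
  | exponential => simp only [slope, loss_exponential]; rw [mul_comm]
  | logistic =>
    -- `r ↦ (1 + r) log (1 + r) / r` is increasing
    have hmono : MonotoneOn (fun r : ℝ => (1 + r) * Real.log (1 + r) / r) (Set.Ioi 0) := by
      refine monotoneOn_of_deriv_nonneg (convex_Ioi 0) ?_ ?_ ?_
      · refine ContinuousOn.div ?_ continuousOn_id fun r hr => ne_of_gt hr
        refine ContinuousOn.mul (by fun_prop) (ContinuousOn.log (by fun_prop) ?_)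
        intro r hr
        have : (0 : ℝ) < r := hr
        positivity
      all_goals
        rw [interior_Ioi]
      all_goals
        intro r hr
        have hr : (0 : ℝ) < r := hr
        have hr1 : (1 + r) ≠ 0 := by positivity
        have h1 : HasDerivAt (fun r : ℝ => 1 + r) 1 r := (hasDerivAt_id r).const_add 1
        have h2 := ((h1.mul (h1.log hr1)).div (hasDerivAt_id r) hr.ne')
      · exact h2.differentiableAt.differentiableWithinAt
      · have h3 : deriv (fun r : ℝ => (1 + r) * Real.log (1 + r) / r) r = _ := h2.deriv
        rw [h3]
        refine div_nonneg ?_ (sq_nonneg _)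
        have h4 : Real.log (1 + r) ≤ 1 + r - 1 := Real.log_le_sub_one_of_pos (by positivity)
        simp only [id, mul_one, one_mul, Pi.mul_apply]
        have : (1 + r) * (1 / (1 + r)) = 1 := by field_simp
        rw [this]
        nlinarith
    have h := hmono (Real.exp_pos (-y)) (Real.exp_pos (-x)) (by gcongr)
    simp only [slope, loss_logistic]
    simp only at h
    rw [div_le_div_iff₀ (by positivity) (by positivity)] at h
    rw [div_mul_eq_mul_div, div_mul_eq_mul_div, div_le_div_iff₀ (by positivity) (by positivity)]
    nlinarith

lemma loss_lossInv {l : ℝ} (hl : 0 < l) : ℓ.loss (ℓ.lossInv l) = l := by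
  cases ℓ with
  | exponential => simp [loss_exponential, lossInv, Real.exp_log hl]
  | logistic =>
    have : 0 < Real.exp l - 1 := by linarith [Real.add_one_lt_exp hl.ne']
    simp [loss_logistic, lossInv, Real.exp_log this]

lemma lossInv_loss (x : ℝ) : ℓ.lossInv (ℓ.loss x) = x :=
  ℓ.loss_strictAnti.injective (ℓ.loss_lossInv (ℓ.loss_pos x))

lemma f_injective : Function.Injective ℓ.f := fun x y h =>
  ℓ.loss_strictAnti.injective (by simp [loss, h])

lemma fInv_log_one_div {l : ℝ} (hl : 0 < l) : ℓ.fInv (Real.log (1 / l)) = ℓ.lossInv l := by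
  have h : ℓ.f (ℓ.lossInv l) = Real.log (1 / l) := by
    have := congrArg Real.log (ℓ.loss_lossInv hl)
    rw [loss, Real.log_exp] at this
    rw [one_div, Real.log_inv]
    linarith
  rw [← h]
  exact Function.leftInverse_invFun ℓ.f_injective _

lemma contDiffAt_lossInv {l : ℝ} (hl : 0 < l) : ContDiffAt ℝ 1 ℓ.lossInv l := by
  cases ℓ with
  | exponential => exact (Real.contDiffAt_log.2 hl.ne').neg
  | logistic =>
    have : 0 < Real.exp l - 1 := by linarith [Real.add_one_lt_exp hl.ne']
    exact ((Real.contDiff_exp.contDiffAt.sub contDiffAt_const).log this.ne').neg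

lemma hasDerivAt_lossInv {l : ℝ} (hl : 0 < l) :
    HasDerivAt ℓ.lossInv (-(ℓ.slope (ℓ.lossInv l))⁻¹) l := by
  have h1 := ((ℓ.contDiffAt_lossInv hl).differentiableAt one_ne_zero).hasDerivAt
  have h2 := (ℓ.hasDerivAt_loss (ℓ.lossInv l)).comp l h1
  have h3 : HasDerivAt (ℓ.loss ∘ ℓ.lossInv) 1 l :=
    (hasDerivAt_id l).congr_of_eventuallyEq
      ((lt_mem_nhds hl).mono fun y hy => ℓ.loss_lossInv hy)
  have h4 := h2.unique h3
  have h5 := ℓ.slope_pos (ℓ.lossInv l)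
  have : deriv ℓ.lossInv l = -(ℓ.slope (ℓ.lossInv l))⁻¹ := by
    field_simp
    linarith
  rwa [this] at h1

lemma lossInv_anti {l l' : ℝ} (hl : 0 < l) (h : l ≤ l') : ℓ.lossInv l' ≤ ℓ.lossInv l := by
  rw [← ℓ.loss_strictAnti.le_iff_ge, ℓ.loss_lossInv hl, ℓ.loss_lossInv (hl.trans_le h)]
  exact h

lemma tendsto_lossInv : Tendsto ℓ.lossInv (𝓝[>] 0) atTop := by
  refine tendsto_atTop.2 fun x => ?_
  filter_upwards [Ioc_mem_nhdsGT (ℓ.loss_pos x)] with l hl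
  have := ℓ.lossInv_anti hl.1 hl.2
  rwa [ℓ.lossInv_loss] at this

end LossKind

/-! ### Absolutely continuous functions -/

lemma AbsolutelyContinuousOnInterval.lipschitzOnWith_comp {X Y : Type*} [PseudoMetricSpace X]
    [PseudoMetricSpace Y] {z : ℝ → X} {a b : ℝ} (hz : AbsolutelyContinuousOnInterval z a b)
    {F : X → Y} {K : NNReal} (hF : LipschitzOnWith K F (z '' Set.uIcc a b)) :
    AbsolutelyContinuousOnInterval (fun t => F (z t)) a b := by
  unfold AbsolutelyContinuousOnInterval at hz ⊢
  refine squeeze_zero' (Eventually.of_forall fun _ => Finset.sum_nonneg fun _ _ => dist_nonneg) ?_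
    (by simpa using hz.const_mul (K : ℝ))
  rw [eventually_inf_principal]
  refine Eventually.of_forall fun I hI => ?_
  rw [Finset.mul_sum]
  refine Finset.sum_le_sum fun i hi => ?_
  exact hF.dist_le_mul _ (Set.mem_image_of_mem _ (hI.1 i hi).1) _
    (Set.mem_image_of_mem _ (hI.1 i hi).2)

lemma AbsolutelyContinuousOnInterval.locallyLipschitzOn_comp {X Y : Type*}
    [SeminormedAddCommGroup X] [PseudoMetricSpace Y] {z : ℝ → X} {a b : ℝ} (hz : AbsolutelyContinuousOnInterval z a b)
    {F : X → Y} (hF : LocallyLipschitzOn (z '' Set.uIcc a b) F) :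
    AbsolutelyContinuousOnInterval (fun t => F (z t)) a b := by
  have hc : IsCompact (z '' Set.uIcc a b) := isCompact_uIcc.image_of_continuousOn hz.continuousOn
  obtain ⟨K, hK⟩ := LocallyLipschitzOn.exists_lipschitzOnWith_of_compact hc hF
  exact hz.lipschitzOnWith_comp hK

lemma AbsolutelyContinuousOnInterval.contDiffAt_comp {V W : Type*} [NormedAddCommGroup V]
    [NormedSpace ℝ V] [NormedAddCommGroup W] [NormedSpace ℝ W] {z : ℝ → V} {a b : ℝ}
    (hz : AbsolutelyContinuousOnInterval z a b) {F : V → W}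
    (hF : ∀ t ∈ Set.uIcc a b, ContDiffAt ℝ 1 F (z t)) :
    AbsolutelyContinuousOnInterval (fun t => F (z t)) a b := by
  refine hz.locallyLipschitzOn_comp ?_
  rintro _ ⟨t, ht, rfl⟩
  obtain ⟨K, s, hs, h⟩ := (hF t ht).exists_lipschitzOnWith
  exact ⟨K, s, mem_nhdsWithin_of_mem_nhds hs, h⟩

lemma AbsolutelyContinuousOnInterval.finset_sum {ι : Type*} (s : Finset ι) {F : ι → ℝ → ℝ}
    {a b : ℝ} (h : ∀ i, AbsolutelyContinuousOnInterval (F i) a b) :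
    AbsolutelyContinuousOnInterval (fun t => ∑ i ∈ s, F i t) a b := by
  classical
  induction s using Finset.induction_on with
  | empty =>
    have h0 : LipschitzOnWith 0 (fun _ : ℝ => (0 : ℝ)) (Set.uIcc a b) :=
      (LipschitzWith.const (0 : ℝ)).lipschitzOnWith
    simpa only [Finset.sum_empty] using h0.absolutelyContinuousOnInterval
  | insert i s hi ih =>
    simp only [Finset.sum_insert hi]
    exact (h i).fun_add ih

/-- The fundamental theorem of calculus for absolutely continuous functions; every monotonicity
argument along the flow goes through it. -/
lemma AbsolutelyContinuousOnInterval.le_of_ae_hasDerivAt_nonpos {F : ℝ → ℝ} {a b : ℝ}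
    (hab : a ≤ b) (hF : AbsolutelyContinuousOnInterval F a b)
    (h : ∀ᵐ t, t ∈ Set.Ioo a b → ∃ d ≤ 0, HasDerivAt F d t) : F b ≤ F a := by
  have h1 := hF.integral_deriv_eq_sub
  rw [intervalIntegral.integral_of_le hab, integral_Ioc_eq_integral_Ioo] at h1
  have h2 : ∫ t in Set.Ioo a b, deriv F t ≤ 0 := by
    refine integral_nonpos_of_ae ?_
    refine (ae_restrict_iff' measurableSet_Ioo).2 ?_
    filter_upwards [h] with t ht htm
    obtain ⟨d, hd, hd'⟩ := ht htm
    rw [hd'.deriv]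
    exact hd
  linarith

/-! ### Regularity of an RMSProp flow -/

/-- The times at which an RMSProp flow `w` with squared inverse conditioner `m` satisfies the
differential equations of the flow and the chain rule for the margins. -/
def IsRegularTime {p N : ℕ} (ℓ : LossKind) (q : Fin N → EuclideanSpace ℝ (Fin p) → ℝ)
    (a ε : ℝ) (w : ℝ → EuclideanSpace ℝ (Fin p)) (m : Fin p → ℝ → ℝ) (t : ℝ) : Prop :=
  ∃ (g w' : EuclideanSpace ℝ (Fin p)) (ξ : Fin N → EuclideanSpace ℝ (Fin p)),
    (∀ i, ξ i ∈ clarkeSubdiff (q i) (w t)) ∧ g = -∑ i, ℓ.slope (q i (w t)) • ξ i ∧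
    (∀ j, w' j = -((Real.sqrt (m j t))⁻¹ * g j)) ∧ HasDerivAt w w' t ∧
    (∀ i, HasDerivAt (fun s => q i (w s)) (inner ℝ (ξ i) w') t) ∧
    ∀ j, HasDerivAt (m j) (a * ((g j) ^ 2 - (m j t - ε))) t

/-- An RMSProp flow `w` together with its squared inverse conditioner `m`. -/
structure IsRMSPath {p N : ℕ} (ℓ : LossKind) (q : Fin N → EuclideanSpace ℝ (Fin p) → ℝ)
    (a ε : ℝ) (w : ℝ → EuclideanSpace ℝ (Fin p)) (m : Fin p → ℝ → ℝ) : Prop where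
  ac : ∀ s t, 0 ≤ s → s ≤ t → AbsolutelyContinuousOnInterval w s t
  ac_m : ∀ j s t, 0 ≤ s → s ≤ t → AbsolutelyContinuousOnInterval (m j) s t
  le_m : ∀ j t, 0 ≤ t → ε ≤ m j t
  m_zero : ∀ j, m j 0 = ε
  m_const : a = 0 → ∀ j t, m j t = ε
  regular : ∀ᵐ t, 0 < t → IsRegularTime ℓ q a ε w m t

lemma AbsolutelyContinuousOnInterval.mono_of_zero {X : Type*} [PseudoMetricSpace X] {z : ℝ → X}
    (h : ∀ T : ℝ, 0 < T → AbsolutelyContinuousOnInterval z 0 T) {s t : ℝ} (hs : 0 ≤ s)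
    (hst : s ≤ t) : AbsolutelyContinuousOnInterval z s t := by
  refine (h (t + 1) (by linarith)).mono ?_
  rw [Set.uIcc_of_le hst, Set.uIcc_of_le (by linarith)]
  exact Set.Icc_subset_Icc hs (by linarith)

lemma ae_pos_of_forall_Icc {P : ℝ → Prop}
    (h : ∀ T : ℝ, 0 < T → ∀ᵐ t, t ∈ Set.Icc 0 T → P t) : ∀ᵐ t : ℝ, 0 < t → P t := by
  have h1 : ∀ᵐ t : ℝ, ∀ n : ℕ, t ∈ Set.Icc (0 : ℝ) (n + 1) → P t :=
    ae_all_iff.2 fun n => h _ (by positivity)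
  filter_upwards [h1] with t ht hpos
  obtain ⟨n, hn⟩ := exists_nat_gt t
  exact ht n ⟨hpos.le, by linarith⟩

/-- Differentiating the memory integral replaces the nonlocal conditioner by an ordinary
differential equation for m, so that later arguments only use derivatives at almost every time. -/
theorem IsRMSPropFlow.exists_isRMSPath {p N : ℕ} (hN : 0 < N) {ℓ : LossKind}
    {q : Fin N → EuclideanSpace ℝ (Fin p) → ℝ} (hLip : ∀ i, LocallyLipschitz (q i))
    (hChain : ∀ i, AdmitsChainRule (q i)) {b ε : ℝ} (hb1 : b ≤ 1)
    {w : ℝ → EuclideanSpace ℝ (Fin p)} (hflow : IsRMSPropFlow b ε (empiricalLoss ℓ q) w) :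
    ∃ m : Fin p → ℝ → ℝ, IsRMSPath ℓ q (1 - b) ε w m := by
  obtain ⟨hac, g, hgm, hg⟩ := hflow
  set a := 1 - b with ha
  have hg' : ∀ᵐ t : ℝ, 0 ≤ t → g t ∈ clarkeSubdiff (empiricalLoss ℓ q) (w t) ∧
      HasDerivAt w (WithLp.toLp 2 fun j => -(rmsConditioner b ε g t j * g t j)) t :=
    (ae_restrict_iff' measurableSet_Ici).1 hg
  have hLoss : LocallyLipschitz (empiricalLoss ℓ q) :=
    LocallyLipschitz.finset_sum_real _ fun i => ℓ.locallyLipschitz_loss.comp (hLip i)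
  -- integrability of the squared subgradients
  have hint : ∀ j, ∀ T : ℝ, 0 < T →
      IntervalIntegrable (fun τ => a * Real.exp (a * τ) * (g τ j) ^ 2) volume 0 T := by
    intro j T hT
    have hc : IsCompact (w '' Set.uIcc 0 T) :=
      isCompact_uIcc.image_of_continuousOn (hac T hT).continuousOn
    obtain ⟨C, hC0, hC⟩ := hLoss.exists_norm_clarkeSubdiff_le hc
    have h1 : IntervalIntegrable (fun τ => (g τ j) ^ 2) volume 0 T := by
      rw [intervalIntegrable_iff_integrableOn_Ioc_of_le hT.le]
      have hmeas : AEStronglyMeasurable (fun τ => (g τ j) ^ 2)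
          (volume.restrict (Set.Ioc 0 T)) := by
        have h2 : AEStronglyMeasurable g (volume.restrict (Set.Ioc 0 T)) :=
          hgm.mono_measure (Measure.restrict_mono
            (fun t ht => ht.1.le) le_rfl)
        have h3 : Continuous fun v : EuclideanSpace ℝ (Fin p) => (v j) ^ 2 := by fun_prop
        exact h3.comp_aestronglyMeasurable h2
      refine Integrable.of_bound hmeas (C ^ 2) ?_
      refine (ae_restrict_iff' measurableSet_Ioc).2 ?_
      filter_upwards [hg'] with t ht htm
      have h4 := hC (w t) (Set.mem_image_of_mem _
        (by rw [Set.uIcc_of_le hT.le]; exact ⟨htm.1.le, htm.2⟩)) _ (ht htm.1.le).1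
      have h5 : ‖g t j‖ ≤ C := (PiLp.norm_apply_le (g t) j).trans h4
      rw [norm_pow]
      gcongr
    exact h1.continuousOn_mul (by fun_prop)
  let m : Fin p → ℝ → ℝ := fun j t => ε + ∫ τ in (0 : ℝ)..t,
      (1 - b) * Real.exp (-(1 - b) * (t - τ)) * (g τ j) ^ 2
  -- Pulling e^(-a t) out of the kernel leaves an integrand independent of t, to which Lebesgue
  -- differentiation applies.
  have hm : ∀ j, m j = fun t => ε + Real.exp (-a * t) *
      ∫ τ in (0 : ℝ)..t, a * Real.exp (a * τ) * (g τ j) ^ 2 := by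
    intro j
    funext t
    simp only [m, ← ha]
    rw [← intervalIntegral.integral_const_mul]
    congr 1
    refine intervalIntegral.integral_congr fun τ _ => ?_
    have : Real.exp (-a * (t - τ)) = Real.exp (-a * t) * Real.exp (a * τ) := by
      rw [← Real.exp_add]; ring_nf
    simp only [this]; ring
  have hacm : ∀ j, ∀ T : ℝ, 0 < T → AbsolutelyContinuousOnInterval (m j) 0 T := by
    intro j T hT
    rw [hm j]
    have h1 := (hint j T hT).absolutelyContinuousOnInterval_intervalIntegral
      (c := 0) Set.left_mem_uIcc
    have h2 : AbsolutelyContinuousOnInterval (fun t : ℝ => Real.exp (-a * t)) 0 T :=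
      ContDiffOn.absolutelyContinuousOnInterval (ContDiff.contDiffOn (by fun_prop))
    have h3 : AbsolutelyContinuousOnInterval (fun _ : ℝ => ε) 0 T :=
      ContDiffOn.absolutelyContinuousOnInterval contDiffOn_const
    exact h3.fun_add (h2.fun_mul h1)
  refine ⟨m, fun s t => .mono_of_zero hac, fun j s t => .mono_of_zero (hacm j), ?_, ?_, ?_, ?_⟩
  · intro j t ht
    have : 0 ≤ ∫ τ in (0 : ℝ)..t, (1 - b) * Real.exp (-(1 - b) * (t - τ)) * (g τ j) ^ 2 := by
      refine intervalIntegral.integral_nonneg ht fun τ _ => ?_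
      have : 0 ≤ 1 - b := by linarith
      positivity
    simp only [m]
    linarith
  · intro j
    simp [m]
  · intro h0 j t
    simp [hm, h0]
  · have hd : ∀ᵐ t : ℝ, 0 < t → ∀ j, HasDerivAt
        (fun t => ∫ τ in (0 : ℝ)..t, a * Real.exp (a * τ) * (g τ j) ^ 2)
        (a * Real.exp (a * t) * (g t j) ^ 2) t := by
      refine ae_pos_of_forall_Icc fun T hT => ?_
      have := ae_all_iff.2 fun j => (hint j T hT).ae_hasDerivAt_integral
      filter_upwards [this] with t ht htm j
      rw [← Set.uIcc_of_le hT.le] at htm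
      exact ht j htm 0 Set.left_mem_uIcc
    have hq : ∀ᵐ t : ℝ, 0 < t → ∀ i, ∀ ξ ∈ clarkeSubdiff (q i) (w t),
        HasDerivAt (fun s => q i (w s)) (inner ℝ ξ (deriv w t)) t := by
      refine ae_pos_of_forall_Icc fun T hT => ?_
      have := ae_all_iff.2 fun i => (ae_restrict_iff' measurableSet_Icc).1
        (hChain i 0 T w hT (hac T hT))
      filter_upwards [this] with t ht htm i
      exact ht i htm
    filter_upwards [hd, hq, hg'] with t h1 h2 h3 htpos
    obtain ⟨h4, h5⟩ := h3 htpos.le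
    -- The chain rule is assumed for the margins only; the splitting of g t lets it act on the loss.
    obtain ⟨ξ, hξ, hsum⟩ := exists_clarkeSubdiff_decomposition hN hLip
      ℓ.locallyLipschitz_loss (fun i => ℓ.slope_pos (q i (w t)))
      (fun i => ℓ.hasStrictDerivAt_loss (q i (w t))) h4
    refine ⟨g t, _, ξ, hξ, hsum, fun j => rfl, h5, fun i => ?_, fun j => ?_⟩
    · have := h2 htpos i _ (hξ i)
      rwa [h5.deriv] at this
    · have h6 := h1 htpos j
      have h7 : HasDerivAt (fun t : ℝ => Real.exp (-a * t)) (Real.exp (-a * t) * -a) t := by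
        simpa using ((hasDerivAt_id t).const_mul (-a)).exp
      have h8 := (h7.mul h6).const_add ε
      have e : Real.exp (-a * t) * Real.exp (a * t) = 1 := by
        rw [← Real.exp_add]; simp
      rw [hm j]
      refine h8.congr_deriv ?_
      linear_combination (a * (g t j) ^ 2) * e

/-! ### Homogeneous margins -/

section Homogeneous

variable {p : ℕ} {φ : EuclideanSpace ℝ (Fin p) → ℝ} {L : ℝ}

lemma apply_zero_of_homogeneous (hL0 : 0 < L)
    (hL : ∀ (α : ℝ) (u : EuclideanSpace ℝ (Fin p)), 0 < α → φ (α • u) = α ^ L * φ u) :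
    φ 0 = 0 := by
  have h := hL 2 0 two_pos
  rw [smul_zero] at h
  have : 1 < (2 : ℝ) ^ L := Real.one_lt_rpow one_lt_two hL0
  exact (mul_eq_zero.1 (show ((2 : ℝ) ^ L - 1) * φ 0 = 0 by linarith)).resolve_left
    (by linarith)

lemma eq_norm_rpow_mul_of_homogeneous
    (hL : ∀ (α : ℝ) (u : EuclideanSpace ℝ (Fin p)), 0 < α → φ (α • u) = α ^ L * φ u)
    {x : EuclideanSpace ℝ (Fin p)} (hx : x ≠ 0) : φ x = ‖x‖ ^ L * φ (‖x‖⁻¹ • x) := by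
  rw [← hL _ _ (norm_pos_iff.2 hx), smul_inv_smul₀ (norm_ne_zero_iff.2 hx)]

lemma exists_le_mul_norm_rpow_of_homogeneous (hφ : Continuous φ)
    (hL : ∀ (α : ℝ) (u : EuclideanSpace ℝ (Fin p)), 0 < α → φ (α • u) = α ^ L * φ u) :
    ∃ B : ℝ, 0 < B ∧ ∀ x, x ≠ 0 → φ x ≤ B * ‖x‖ ^ L := by
  obtain ⟨C, hC⟩ := (isCompact_sphere (0 : EuclideanSpace ℝ (Fin p)) 1).exists_bound_of_continuousOn
    hφ.continuousOn
  refine ⟨|C| + 1, by positivity, fun x hx => ?_⟩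
  rw [eq_norm_rpow_mul_of_homogeneous hL hx, mul_comm]
  have h1 := hC (‖x‖⁻¹ • x) (by simp [norm_smul, hx])
  have h2 := le_abs_self (φ (‖x‖⁻¹ • x))
  rw [Real.norm_eq_abs] at h1
  have h3 := le_abs_self C
  gcongr
  linarith

/-- Subgradients are homogeneous of degree L - 1, so a bound on the compact unit sphere suffices. -/
lemma exists_norm_le_mul_norm_rpow_of_homogeneous (hφ : LocallyLipschitz φ)
    (hL : ∀ (α : ℝ) (u : EuclideanSpace ℝ (Fin p)), 0 < α → φ (α • u) = α ^ L * φ u) :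
    ∃ B : ℝ, 0 ≤ B ∧ ∀ x, x ≠ 0 → ∀ ξ ∈ clarkeSubdiff φ x, ‖ξ‖ ≤ B * ‖x‖ ^ (L - 1) := by
  obtain ⟨B, hB0, hB⟩ := hφ.exists_norm_clarkeSubdiff_le
    (isCompact_sphere (0 : EuclideanSpace ℝ (Fin p)) 1)
  refine ⟨B, hB0, fun x hx ξ hξ => ?_⟩
  have hn : 0 < ‖x‖ := norm_pos_iff.2 hx
  have h1 := smul_mem_clarkeSubdiff_of_homogeneous hφ hL hξ (inv_pos.2 hn)
  have h2 := hB (‖x‖⁻¹ • x) (by simp [norm_smul, hx]) _ h1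
  have h3 : 0 < ‖x‖ ^ (L - 1) := Real.rpow_pos_of_pos hn _
  rw [norm_smul, Real.norm_eq_abs, Real.inv_rpow hn.le, abs_of_pos (inv_pos.2 h3),
    inv_mul_le_iff₀ h3] at h2
  linarith

end Homogeneous

/-! ### The smoothed margin along an RMSProp flow -/

/-- The squared norm `∑ j, h_j⁻¹ w_j²` of the parameters in the metric of the flow. -/
noncomputable def condNormSq {p : ℕ} (w : ℝ → EuclideanSpace ℝ (Fin p)) (m : Fin p → ℝ → ℝ)
    (t : ℝ) : ℝ := ∑ j, Real.sqrt (m j t) * (w t j) ^ 2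

/-- The sum `∑ i, e^{-f(q_i)} f'(q_i) q_i` of margins weighted by the slopes of the loss. -/
noncomputable def marginSum {p N : ℕ} (ℓ : LossKind) (q : Fin N → EuclideanSpace ℝ (Fin p) → ℝ)
    (x : EuclideanSpace ℝ (Fin p)) : ℝ := ∑ i, ℓ.slope (q i x) * q i x

/-- An RMSProp path of homogeneous margins that separates the data at time `t₀`. -/
structure IsSeparatedPath {p N : ℕ} (ℓ : LossKind) (q : Fin N → EuclideanSpace ℝ (Fin p) → ℝ)
    (L a ε : ℝ) (w : ℝ → EuclideanSpace ℝ (Fin p)) (m : Fin p → ℝ → ℝ) (t₀ : ℝ) : Prop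
    extends IsRMSPath ℓ q a ε w m where
  lip : ∀ i, LocallyLipschitz (q i)
  N_pos : 0 < N
  L_pos : 0 < L
  hom : ∀ (i : Fin N) (α : ℝ) (u : EuclideanSpace ℝ (Fin p)), 0 < α → q i (α • u) = α ^ L * q i u
  a_nonneg : 0 ≤ a
  eps_pos : 0 < ε
  t₀_nonneg : 0 ≤ t₀
  margin_pos : 0 < ℓ.lossInv (empiricalLoss ℓ q (w t₀))

namespace IsSeparatedPath

variable {p N : ℕ} {ℓ : LossKind} {q : Fin N → EuclideanSpace ℝ (Fin p) → ℝ} {L a ε : ℝ}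
  {w : ℝ → EuclideanSpace ℝ (Fin p)} {m : Fin p → ℝ → ℝ} {t₀ t s : ℝ}

lemma m_pos (H : IsSeparatedPath ℓ q L a ε w m t₀) (ht : 0 ≤ t) (j : Fin p) : 0 < m j t :=
  H.eps_pos.trans_le (H.le_m j t ht)

lemma sqrt_m_pos (H : IsSeparatedPath ℓ q L a ε w m t₀) (ht : 0 ≤ t) (j : Fin p) :
    0 < Real.sqrt (m j t) := Real.sqrt_pos.2 (H.m_pos ht j)

lemma sqrt_eps_le (H : IsSeparatedPath ℓ q L a ε w m t₀) (ht : 0 ≤ t) (j : Fin p) :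
    Real.sqrt ε ≤ Real.sqrt (m j t) := Real.sqrt_le_sqrt (H.le_m j t ht)

lemma sqrt_eps_pos (H : IsSeparatedPath ℓ q L a ε w m t₀) : 0 < Real.sqrt ε :=
  Real.sqrt_pos.2 H.eps_pos

lemma loss_pos (H : IsSeparatedPath ℓ q L a ε w m t₀) (x : EuclideanSpace ℝ (Fin p)) :
    0 < empiricalLoss ℓ q x := by
  have : Nonempty (Fin N) := ⟨⟨0, H.N_pos⟩⟩
  exact Finset.sum_pos (fun i _ => ℓ.loss_pos _) Finset.univ_nonempty

lemma ac_loss (H : IsSeparatedPath ℓ q L a ε w m t₀) (hs : 0 ≤ s) (hst : s ≤ t) :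
    AbsolutelyContinuousOnInterval (fun τ => empiricalLoss ℓ q (w τ)) s t :=
  (H.ac s t hs hst).locallyLipschitzOn_comp
    ((LocallyLipschitz.finset_sum_real _ fun i => ℓ.locallyLipschitz_loss.comp
      (H.lip i)).locallyLipschitzOn)

lemma ac_sqrt_m (H : IsSeparatedPath ℓ q L a ε w m t₀) (j : Fin p) (hs : 0 ≤ s) (hst : s ≤ t) :
    AbsolutelyContinuousOnInterval (fun τ => Real.sqrt (m j τ)) s t := by
  refine (H.ac_m j s t hs hst).contDiffAt_comp fun τ hτ => Real.contDiffAt_sqrt ?_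
  rw [Set.uIcc_of_le hst] at hτ
  exact (H.m_pos (hs.trans hτ.1) j).ne'

lemma ac_condNormSq (H : IsSeparatedPath ℓ q L a ε w m t₀) (hs : 0 ≤ s) (hst : s ≤ t) :
    AbsolutelyContinuousOnInterval (condNormSq w m) s t := by
  refine AbsolutelyContinuousOnInterval.finset_sum _ fun j => ?_
  refine (H.ac_sqrt_m j hs hst).fun_mul ?_
  exact (H.ac s t hs hst).contDiffAt_comp
    (F := fun x : EuclideanSpace ℝ (Fin p) => (x j) ^ 2)
    fun τ _ => ContDiff.contDiffAt (by fun_prop)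

/-- A quantity which is nonincreasing to first order at regular times is nonincreasing. -/
lemma le_of_regular (H : IsSeparatedPath ℓ q L a ε w m t₀) {F : ℝ → ℝ} (hs : 0 ≤ s) (hst : s ≤ t)
    (hF : AbsolutelyContinuousOnInterval F s t)
    (h : ∀ τ ∈ Set.Ioo s t, IsRegularTime ℓ q a ε w m τ → ∃ d ≤ 0, HasDerivAt F d τ) :
    F t ≤ F s := by
  refine hF.le_of_ae_hasDerivAt_nonpos hst ?_
  filter_upwards [H.regular] with τ hτ hτm
  exact h τ hτm (hτ (hs.trans_lt hτm.1))

lemma loss_hasDerivAt {w' g : EuclideanSpace ℝ (Fin p)} {ξ : Fin N → EuclideanSpace ℝ (Fin p)}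
    (hg : g = -∑ i, ℓ.slope (q i (w t)) • ξ i)
    (hw' : ∀ j, w' j = -((Real.sqrt (m j t))⁻¹ * g j))
    (hq : ∀ i, HasDerivAt (fun s => q i (w s)) (inner ℝ (ξ i) w') t) :
    HasDerivAt (fun τ => empiricalLoss ℓ q (w τ))
      (-∑ j, (Real.sqrt (m j t))⁻¹ * (g j) ^ 2) t := by
  have h1 : HasDerivAt (fun τ => ∑ i, ℓ.loss (q i (w τ)))
      (∑ i, -ℓ.slope (q i (w t)) * inner ℝ (ξ i) w') t :=
    HasDerivAt.fun_sum fun i _ => (ℓ.hasDerivAt_loss _).comp t (hq i)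
  refine h1.congr_deriv ?_
  have h2 : inner ℝ g w' = ∑ i, -ℓ.slope (q i (w t)) * inner ℝ (ξ i) w' := by
    rw [hg, inner_neg_left, sum_inner, ← Finset.sum_neg_distrib]
    exact Finset.sum_congr rfl fun i _ => by rw [real_inner_smul_left]; ring
  rw [← h2, PiLp.inner_apply, ← Finset.sum_neg_distrib]
  refine Finset.sum_congr rfl fun j _ => ?_
  rw [hw' j]
  simp
  ring

lemma inner_grad_self (H : IsSeparatedPath ℓ q L a ε w m t₀) {x g : EuclideanSpace ℝ (Fin p)}
    {ξ : Fin N → EuclideanSpace ℝ (Fin p)} (hξ : ∀ i, ξ i ∈ clarkeSubdiff (q i) x)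
    (hg : g = -∑ i, ℓ.slope (q i x) • ξ i) : ∑ j, g j * x j = -(L * marginSum ℓ q x) := by
  have h1 : ∑ j, g j * x j = inner ℝ g x := by
    rw [PiLp.inner_apply]
    exact Finset.sum_congr rfl fun j _ => by simp [mul_comm]
  rw [h1, hg, inner_neg_left, sum_inner, marginSum, Finset.mul_sum]
  congr 1
  refine Finset.sum_congr rfl fun i _ => ?_
  rw [real_inner_smul_left,
    inner_self_of_mem_clarkeSubdiff_of_homogeneous (H.lip i) (H.hom i) (hξ i)]
  ring

/-- First order behaviour of the loss and of `condNormSq` at a regular time. -/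
lemma exists_derivs (H : IsSeparatedPath ℓ q L a ε w m t₀) (ht : 0 ≤ t)
    (h : IsRegularTime ℓ q a ε w m t) :
    ∃ (g w' : EuclideanSpace ℝ (Fin p)) (ξ : Fin N → EuclideanSpace ℝ (Fin p)),
      (∀ i, ξ i ∈ clarkeSubdiff (q i) (w t)) ∧ g = -∑ i, ℓ.slope (q i (w t)) • ξ i ∧
      (∀ j, w' j = -((Real.sqrt (m j t))⁻¹ * g j)) ∧ HasDerivAt w w' t ∧
      (∀ j, HasDerivAt (m j) (a * ((g j) ^ 2 - (m j t - ε))) t) ∧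
      HasDerivAt (fun τ => empiricalLoss ℓ q (w τ))
        (-∑ j, (Real.sqrt (m j t))⁻¹ * (g j) ^ 2) t ∧
      ∑ j, g j * w t j = -(L * marginSum ℓ q (w t)) ∧
      ∃ d, HasDerivAt (condNormSq w m) d t ∧
        d ≤ 2 * L * marginSum ℓ q (w t) + a / (2 * Real.sqrt ε) *
          (∑ j, (Real.sqrt (m j t))⁻¹ * (g j) ^ 2) * condNormSq w m t := by
  obtain ⟨g, w', ξ, hξ, hg, hw', hw, hq, hm⟩ := h
  have hin := H.inner_grad_self hξ hg
  refine ⟨g, w', ξ, hξ, hg, hw', hw, hm, loss_hasDerivAt hg hw' hq, hin, ?_⟩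
  have hwj : ∀ j, HasDerivAt (fun τ => w τ j) (w' j) t := fun j =>
    (PiLp.proj 2 (fun _ : Fin p => ℝ) j :
      EuclideanSpace ℝ (Fin p) →L[ℝ] ℝ).hasFDerivAt.comp_hasDerivAt t hw
  have hd : HasDerivAt (condNormSq w m) (∑ j,
      (a * ((g j) ^ 2 - (m j t - ε)) / (2 * Real.sqrt (m j t)) * (w t j) ^ 2
        + Real.sqrt (m j t) * (2 * w t j * w' j))) t := by
    refine HasDerivAt.fun_sum fun j _ => ?_
    have h1 := ((hm j).sqrt (H.m_pos ht j).ne').mul ((hwj j).pow 2)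
    refine h1.congr_deriv ?_
    simp
  refine ⟨_, hd, ?_⟩
  set D := ∑ j, (Real.sqrt (m j t))⁻¹ * (g j) ^ 2 with hD
  have hDj : ∀ j, (Real.sqrt (m j t))⁻¹ * (g j) ^ 2 ≤ D := fun j =>
    Finset.single_le_sum (f := fun j => (Real.sqrt (m j t))⁻¹ * (g j) ^ 2)
      (fun i _ => by positivity) (Finset.mem_univ j)
  have e : 2 * L * marginSum ℓ q (w t) = ∑ j, -2 * (g j * w t j) := by
    rw [← Finset.mul_sum, hin]; ring
  rw [e, condNormSq, Finset.mul_sum, ← Finset.sum_add_distrib]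
  refine Finset.sum_le_sum fun j _ => ?_
  have hr := H.sqrt_m_pos ht j
  have hr2 := H.sqrt_eps_le ht j
  have hε := H.sqrt_eps_pos
  have ha := H.a_nonneg
  have h1 : Real.sqrt (m j t) * (2 * w t j * w' j) = -2 * (g j * w t j) := by
    rw [hw' j]; field_simp
  rw [h1]
  -- Bounds the growth of the metric. The relaxation term -(m - ε) has the favourable sign and is
  -- dropped; one summand is at most `D`, and √ε ≤ √m_j restores the weight needed to recover ρ².
  have h2 : a * ((g j) ^ 2 - (m j t - ε)) / (2 * Real.sqrt (m j t))
      ≤ a / (2 * Real.sqrt ε) * D * Real.sqrt (m j t) := by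
    calc a * ((g j) ^ 2 - (m j t - ε)) / (2 * Real.sqrt (m j t))
        ≤ a * (g j) ^ 2 / (2 * Real.sqrt (m j t)) := by
          gcongr
          linarith [H.le_m j t ht]
      _ = a / 2 * ((Real.sqrt (m j t))⁻¹ * (g j) ^ 2) := by field_simp
      _ ≤ a / 2 * D := by gcongr; exact hDj j
      _ = a / (2 * Real.sqrt ε) * D * Real.sqrt ε := by field_simp
      _ ≤ _ := by
          have : 0 ≤ D := Finset.sum_nonneg fun j _ => by positivity
          gcongr
  have h3 := mul_le_mul_of_nonneg_right h2 (sq_nonneg (w t j))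
  linarith

lemma loss_anti (H : IsSeparatedPath ℓ q L a ε w m t₀) (hs : 0 ≤ s) (hst : s ≤ t) :
    empiricalLoss ℓ q (w t) ≤ empiricalLoss ℓ q (w s) := by
  refine H.le_of_regular hs hst (H.ac_loss hs hst) fun τ hτ hreg => ?_
  obtain ⟨g, w', ξ, -, -, -, -, -, hd, -⟩ := H.exists_derivs (hs.trans hτ.1.le) hreg
  exact ⟨_, neg_nonpos.2 (Finset.sum_nonneg fun j _ => by positivity), hd⟩

/-- The conditioner stays bounded away from zero. -/
lemma exists_sqrt_m_le (H : IsSeparatedPath ℓ q L a ε w m t₀) :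
    ∃ M : ℝ, 0 < M ∧ ∀ j t, 0 ≤ t → Real.sqrt (m j t) ≤ M := by
  have ha := H.a_nonneg
  have hl := H.loss_pos (w 0)
  have hε := H.sqrt_eps_pos
  -- √m_j grows at rate at most (a/2) D, so √m_j + (a/2) 𝓛 is nonincreasing; the bound is its value
  -- at time 0.
  refine ⟨Real.sqrt ε + a / 2 * empiricalLoss ℓ q (w 0), by positivity, fun j t ht => ?_⟩
  have key := H.le_of_regular (F := fun τ => Real.sqrt (m j τ) + a / 2 * empiricalLoss ℓ q (w τ))
    le_rfl ht ((H.ac_sqrt_m j le_rfl ht).fun_add ((H.ac_loss le_rfl ht).const_mul _)) ?_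
  · simp only [H.m_zero] at key
    have := mul_nonneg (div_nonneg ha zero_le_two) (H.loss_pos (w t)).le
    linarith
  · intro τ hτ hreg
    obtain ⟨g, w', ξ, -, -, -, -, hm, hd, -⟩ := H.exists_derivs hτ.1.le hreg
    refine ⟨_, ?_, ((hm j).sqrt (H.m_pos hτ.1.le j).ne').add (hd.const_mul (a / 2))⟩
    have hr := H.sqrt_m_pos hτ.1.le j
    have h1 : (Real.sqrt (m j τ))⁻¹ * (g j) ^ 2 ≤ ∑ j, (Real.sqrt (m j τ))⁻¹ * (g j) ^ 2 :=
      Finset.single_le_sum (f := fun j => (Real.sqrt (m j τ))⁻¹ * (g j) ^ 2)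
        (fun i _ => by positivity) (Finset.mem_univ j)
    have h2 : a * ((g j) ^ 2 - (m j τ - ε)) / (2 * Real.sqrt (m j τ))
        ≤ a / 2 * ((Real.sqrt (m j τ))⁻¹ * (g j) ^ 2) := by
      calc a * ((g j) ^ 2 - (m j τ - ε)) / (2 * Real.sqrt (m j τ))
          ≤ a * (g j) ^ 2 / (2 * Real.sqrt (m j τ)) := by
            gcongr
            linarith [H.le_m j τ hτ.1.le]
        _ = _ := by field_simp
    have h3 := mul_le_mul_of_nonneg_left h1 (show 0 ≤ a / 2 by positivity)
    linarith

end IsSeparatedPath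

/-! ### Monotonicity of the smoothed margin; limits of the loss, the norm and the conditioner -/

namespace IsSeparatedPath

variable {p N : ℕ} {ℓ : LossKind} {q : Fin N → EuclideanSpace ℝ (Fin p) → ℝ} {L a ε : ℝ}
  {w : ℝ → EuclideanSpace ℝ (Fin p)} {m : Fin p → ℝ → ℝ} {t₀ t s : ℝ}

/-- Each individual loss is at most the total, and the loss function decreases. -/
lemma lossInv_le_margin (H : IsSeparatedPath ℓ q L a ε w m t₀) (x : EuclideanSpace ℝ (Fin p))
    (i : Fin N) : ℓ.lossInv (empiricalLoss ℓ q x) ≤ q i x := by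
  rw [← ℓ.loss_strictAnti.le_iff_ge, ℓ.loss_lossInv (H.loss_pos x)]
  exact Finset.single_le_sum (f := fun i => ℓ.loss (q i x)) (fun i _ => (ℓ.loss_pos _).le)
    (Finset.mem_univ i)

lemma lossInv_ge (H : IsSeparatedPath ℓ q L a ε w m t₀) (ht : t₀ ≤ t) :
    ℓ.lossInv (empiricalLoss ℓ q (w t₀)) ≤ ℓ.lossInv (empiricalLoss ℓ q (w t)) :=
  ℓ.lossInv_anti (H.loss_pos _) (H.loss_anti H.t₀_nonneg ht)

lemma lossInv_pos (H : IsSeparatedPath ℓ q L a ε w m t₀) (ht : t₀ ≤ t) :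
    0 < ℓ.lossInv (empiricalLoss ℓ q (w t)) := H.margin_pos.trans_le (H.lossInv_ge ht)

lemma w_ne_zero (H : IsSeparatedPath ℓ q L a ε w m t₀) (ht : t₀ ≤ t) : w t ≠ 0 := by
  intro h0
  have h1 := (H.lossInv_pos ht).trans_le (H.lossInv_le_margin (w t) ⟨0, H.N_pos⟩)
  rw [h0, apply_zero_of_homogeneous H.L_pos (H.hom _)] at h1
  exact lt_irrefl _ h1

lemma sqrt_eps_mul_le_condNormSq (H : IsSeparatedPath ℓ q L a ε w m t₀) (ht : 0 ≤ t) :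
    Real.sqrt ε * ‖w t‖ ^ 2 ≤ condNormSq w m t := by
  rw [EuclideanSpace.real_norm_sq_eq, condNormSq, Finset.mul_sum]
  refine Finset.sum_le_sum fun j _ => ?_
  gcongr
  exact H.le_m j t ht

lemma condNormSq_pos (H : IsSeparatedPath ℓ q L a ε w m t₀) (ht : t₀ ≤ t) :
    0 < condNormSq w m t := by
  refine lt_of_lt_of_le ?_ (H.sqrt_eps_mul_le_condNormSq (H.t₀_nonneg.trans ht))
  have := H.sqrt_eps_pos
  have := norm_pos_iff.2 (H.w_ne_zero ht)
  positivity

lemma condNormSq_le {M : ℝ} (hM : ∀ j, Real.sqrt (m j t) ≤ M) :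
    condNormSq w m t ≤ M * ‖w t‖ ^ 2 := by
  rw [EuclideanSpace.real_norm_sq_eq, condNormSq, Finset.mul_sum]
  refine Finset.sum_le_sum fun j _ => ?_
  gcongr
  exact hM j

lemma lossInv_mul_sum_slope_le (H : IsSeparatedPath ℓ q L a ε w m t₀)
    (x : EuclideanSpace ℝ (Fin p)) :
    ℓ.lossInv (empiricalLoss ℓ q x) * ∑ i, ℓ.slope (q i x) ≤ marginSum ℓ q x := by
  rw [marginSum, Finset.mul_sum]
  refine Finset.sum_le_sum fun i _ => ?_
  rw [mul_comm]
  have := ℓ.slope_pos (q i x)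
  gcongr
  exact H.lossInv_le_margin x i

/-- Every margin dominates the smoothed margin, so slope / loss is at least as large there;
weighting by the individual losses and summing gives the claim. -/
lemma slope_lossInv_le (H : IsSeparatedPath ℓ q L a ε w m t₀) (x : EuclideanSpace ℝ (Fin p)) :
    ℓ.slope (ℓ.lossInv (empiricalLoss ℓ q x)) ≤ ∑ i, ℓ.slope (q i x) := by
  have hl := H.loss_pos x
  refine le_of_mul_le_mul_right ?_ hl
  have h1 : ∀ i, ℓ.slope (ℓ.lossInv (empiricalLoss ℓ q x)) * ℓ.loss (q i x)
      ≤ ℓ.slope (q i x) * empiricalLoss ℓ q x := fun i => by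
    have := ℓ.slope_mul_loss_le (H.lossInv_le_margin x i)
    rwa [ℓ.loss_lossInv hl] at this
  rw [Finset.sum_mul]
  refine le_trans (le_of_eq ?_) (Finset.sum_le_sum fun i _ => h1 i)
  rw [← Finset.mul_sum]
  rfl

lemma lossInv_mul_slope_le (H : IsSeparatedPath ℓ q L a ε w m t₀) (ht : t₀ ≤ t) :
    ℓ.lossInv (empiricalLoss ℓ q (w t)) * ℓ.slope (ℓ.lossInv (empiricalLoss ℓ q (w t)))
      ≤ marginSum ℓ q (w t) := by
  refine le_trans ?_ (H.lossInv_mul_sum_slope_le (w t))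
  have := H.lossInv_pos ht
  gcongr
  exact H.slope_lossInv_le (w t)

lemma marginSum_pos (H : IsSeparatedPath ℓ q L a ε w m t₀) (ht : t₀ ≤ t) :
    0 < marginSum ℓ q (w t) :=
  (mul_pos (H.lossInv_pos ht) (ℓ.slope_pos _)).trans_le (H.lossInv_mul_slope_le ht)

/-- The logarithm of the smoothed margin, corrected by a multiple of the loss. -/
noncomputable def logMargin (ℓ : LossKind) (q : Fin N → EuclideanSpace ℝ (Fin p) → ℝ)
    (L a ε : ℝ) (w : ℝ → EuclideanSpace ℝ (Fin p)) (m : Fin p → ℝ → ℝ) (t : ℝ) : ℝ :=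
  Real.log (ℓ.lossInv (empiricalLoss ℓ q (w t)))
    - (L / 2 * Real.log (condNormSq w m t)
      + L / 2 * (a / (2 * Real.sqrt ε)) * empiricalLoss ℓ q (w t))

lemma ac_log_condNormSq (H : IsSeparatedPath ℓ q L a ε w m t₀) (hs : t₀ ≤ s) (hst : s ≤ t) :
    AbsolutelyContinuousOnInterval (fun τ => Real.log (condNormSq w m τ)) s t := by
  refine (H.ac_condNormSq (H.t₀_nonneg.trans hs) hst).contDiffAt_comp fun τ hτ =>
    Real.contDiffAt_log.2 ?_
  rw [Set.uIcc_of_le hst] at hτ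
  exact (H.condNormSq_pos (hs.trans hτ.1)).ne'

lemma ac_logMargin (H : IsSeparatedPath ℓ q L a ε w m t₀) (hs : t₀ ≤ s) (hst : s ≤ t) :
    AbsolutelyContinuousOnInterval (logMargin ℓ q L a ε w m) s t := by
  have h0 := H.t₀_nonneg.trans hs
  have h1 : AbsolutelyContinuousOnInterval
      (fun τ => Real.log (ℓ.lossInv (empiricalLoss ℓ q (w τ)))) s t := by
    refine (H.ac_loss h0 hst).contDiffAt_comp (F := fun l => Real.log (ℓ.lossInv l))
      fun τ hτ => ?_
    rw [Set.uIcc_of_le hst] at hτ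
    exact (ℓ.contDiffAt_lossInv (H.loss_pos _)).log (H.lossInv_pos (hs.trans hτ.1)).ne'
  exact h1.fun_sub (((H.ac_log_condNormSq hs hst).const_mul _).fun_add
    ((H.ac_loss h0 hst).const_mul _))

/-- Cauchy–Schwarz for ⟪g, w⟫ with the dual weights m_j^(-1/2) and m_j^(1/2). Its near-equality case
later produces alignment. -/
lemma sq_marginSum_le (H : IsSeparatedPath ℓ q L a ε w m t₀) (ht : 0 ≤ t)
    {g : EuclideanSpace ℝ (Fin p)} (hin : ∑ j, g j * w t j = -(L * marginSum ℓ q (w t))) :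
    (L * marginSum ℓ q (w t)) ^ 2
      ≤ (∑ j, (Real.sqrt (m j t))⁻¹ * (g j) ^ 2) * condNormSq w m t := by
  rw [← neg_sq, ← hin]
  refine Finset.sum_sq_le_sum_mul_sum_of_sq_le_mul _ (fun j _ => by positivity)
    (fun j _ => by positivity) fun j _ => le_of_eq ?_
  have := (H.sqrt_m_pos ht j).ne'
  field_simp

/-- Growth of the corrected smoothed margin and of the norm at regular times. -/
lemma exists_logMargin_deriv (H : IsSeparatedPath ℓ q L a ε w m t₀) (ht : t₀ ≤ t)
    {g : EuclideanSpace ℝ (Fin p)}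
    (hd : HasDerivAt (fun τ => empiricalLoss ℓ q (w τ))
        (-∑ j, (Real.sqrt (m j t))⁻¹ * (g j) ^ 2) t) {d : ℝ}
    (hr : HasDerivAt (condNormSq w m) d t)
    (hle : d ≤ 2 * L * marginSum ℓ q (w t) + a / (2 * Real.sqrt ε) *
          (∑ j, (Real.sqrt (m j t))⁻¹ * (g j) ^ 2) * condNormSq w m t) :
    ∃ e, HasDerivAt (logMargin ℓ q L a ε w m) e t ∧
      (∑ j, (Real.sqrt (m j t))⁻¹ * (g j) ^ 2) / marginSum ℓ q (w t)
        - L ^ 2 * (marginSum ℓ q (w t) / condNormSq w m t) ≤ e := by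
  set D := ∑ j, (Real.sqrt (m j t))⁻¹ * (g j) ^ 2 with hD
  have hD0 : 0 ≤ D := Finset.sum_nonneg fun j _ => by positivity
  have hy := H.lossInv_pos ht
  have hρ := H.condNormSq_pos ht
  have h1 : HasDerivAt (fun τ => Real.log (ℓ.lossInv (empiricalLoss ℓ q (w τ))))
      (-(ℓ.slope (ℓ.lossInv (empiricalLoss ℓ q (w t))))⁻¹ * -D /
        ℓ.lossInv (empiricalLoss ℓ q (w t))) t :=
    ((ℓ.hasDerivAt_lossInv (H.loss_pos (w t))).comp t hd).log hy.ne'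
  refine ⟨_, h1.sub (((hr.log hρ.ne').const_mul (L / 2)).add (hd.const_mul _)), ?_⟩
  have hs := ℓ.slope_pos (ℓ.lossInv (empiricalLoss ℓ q (w t)))
  have hν := H.marginSum_pos ht
  have h2 : D / marginSum ℓ q (w t) ≤ -(ℓ.slope (ℓ.lossInv (empiricalLoss ℓ q (w t))))⁻¹ * -D /
      ℓ.lossInv (empiricalLoss ℓ q (w t)) := by
    have : -(ℓ.slope (ℓ.lossInv (empiricalLoss ℓ q (w t))))⁻¹ * -D /
        ℓ.lossInv (empiricalLoss ℓ q (w t)) = D / (ℓ.lossInv (empiricalLoss ℓ q (w t)) *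
          ℓ.slope (ℓ.lossInv (empiricalLoss ℓ q (w t)))) := by
      field_simp
    rw [this]
    gcongr
    exact H.lossInv_mul_slope_le ht
  have hL := H.L_pos
  have h3 : L / 2 * (d / condNormSq w m t) ≤ L ^ 2 * (marginSum ℓ q (w t) / condNormSq w m t)
      + L / 2 * (a / (2 * Real.sqrt ε)) * D := by
    calc L / 2 * (d / condNormSq w m t) ≤ L / 2 * ((2 * L * marginSum ℓ q (w t)
          + a / (2 * Real.sqrt ε) * D * condNormSq w m t) / condNormSq w m t) := by gcongr
      _ = _ := by field_simp
  linarith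

lemma logMargin_mono (H : IsSeparatedPath ℓ q L a ε w m t₀) (hs : t₀ ≤ s) (hst : s ≤ t) :
    logMargin ℓ q L a ε w m s ≤ logMargin ℓ q L a ε w m t := by
  have := H.le_of_regular (F := fun τ => -logMargin ℓ q L a ε w m τ) (H.t₀_nonneg.trans hs) hst
    (H.ac_logMargin hs hst).fun_neg ?_
  · linarith
  · intro τ hτ hreg
    have h0 : t₀ ≤ τ := hs.trans hτ.1.le
    obtain ⟨g, w', ξ, -, -, -, -, -, hd, hin, d, hr, hle⟩ :=
      H.exists_derivs (H.t₀_nonneg.trans h0) hreg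
    obtain ⟨e, he, hle'⟩ := H.exists_logMargin_deriv h0 hd hr hle
    refine ⟨-e, ?_, he.neg⟩
    have h1 := H.sq_marginSum_le (H.t₀_nonneg.trans h0) hin
    have hν := H.marginSum_pos h0
    have hρ := H.condNormSq_pos h0
    have h2 : L ^ 2 * (marginSum ℓ q (w τ) / condNormSq w m τ)
        ≤ (∑ j, (Real.sqrt (m j τ))⁻¹ * (g j) ^ 2) / marginSum ℓ q (w τ) := by
      rw [mul_div_assoc', div_le_div_iff₀ hρ hν]
      linarith
    linarith

lemma log_lossInv_ge (H : IsSeparatedPath ℓ q L a ε w m t₀) (ht : t₀ ≤ t) :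
    L / 2 * Real.log (condNormSq w m t) + logMargin ℓ q L a ε w m t₀
      ≤ Real.log (ℓ.lossInv (empiricalLoss ℓ q (w t))) := by
  have h1 := H.logMargin_mono le_rfl ht
  have h2 : 0 ≤ L / 2 * (a / (2 * Real.sqrt ε)) * empiricalLoss ℓ q (w t) := by
    have := H.L_pos
    have := H.a_nonneg
    have := H.loss_pos (w t)
    positivity
  unfold logMargin at h1 ⊢
  linarith

/-- The normalized margins stay bounded away from zero. -/
lemma exists_mul_norm_rpow_le (H : IsSeparatedPath ℓ q L a ε w m t₀) :
    ∃ γ : ℝ, 0 < γ ∧ ∀ t, t₀ ≤ t → γ * ‖w t‖ ^ L ≤ ℓ.lossInv (empiricalLoss ℓ q (w t)) := by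
  refine ⟨Real.exp (logMargin ℓ q L a ε w m t₀ + L / 2 * Real.log (Real.sqrt ε)),
    Real.exp_pos _, fun t ht => ?_⟩
  have hw := norm_pos_iff.2 (H.w_ne_zero ht)
  have hε := H.sqrt_eps_pos
  have hL := H.L_pos
  rw [Real.rpow_def_of_pos hw, ← Real.exp_add, ← Real.le_log_iff_exp_le (H.lossInv_pos ht)]
  refine le_trans ?_ (H.log_lossInv_ge ht)
  have h1 : Real.log (Real.sqrt ε) + 2 * Real.log ‖w t‖ ≤ Real.log (condNormSq w m t) := by
    have := Real.log_le_log (by positivity)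
      (H.sqrt_eps_mul_le_condNormSq (H.t₀_nonneg.trans ht))
    rwa [Real.log_mul hε.ne' (by positivity), Real.log_pow, Nat.cast_ofNat] at this
  have h2 := mul_le_mul_of_nonneg_left h1 (show 0 ≤ L / 2 by positivity)
  linarith

/-- A single margin grows at most like ‖w‖^L and dominates the smoothed margin. This bounds
`logMargin` from above and forces the norm to diverge with the smoothed margin. -/
lemma exists_log_lossInv_le (H : IsSeparatedPath ℓ q L a ε w m t₀) :
    ∃ C : ℝ, ∀ t, t₀ ≤ t → Real.log (ℓ.lossInv (empiricalLoss ℓ q (w t)))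
      ≤ L / 2 * Real.log (condNormSq w m t) + C := by
  obtain ⟨B, hB, h⟩ := exists_le_mul_norm_rpow_of_homogeneous (H.lip ⟨0, H.N_pos⟩).continuous
    (H.hom ⟨0, H.N_pos⟩)
  refine ⟨Real.log B - L / 2 * Real.log (Real.sqrt ε), fun t ht => ?_⟩
  have hw := norm_pos_iff.2 (H.w_ne_zero ht)
  have hε := H.sqrt_eps_pos
  have hL := H.L_pos
  have h0 := Real.log_le_log (H.lossInv_pos ht)
    ((H.lossInv_le_margin (w t) ⟨0, H.N_pos⟩).trans (h _ (H.w_ne_zero ht)))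
  rw [Real.log_mul hB.ne' (Real.rpow_pos_of_pos hw _).ne', Real.log_rpow hw] at h0
  have h1 : Real.log (Real.sqrt ε) + 2 * Real.log ‖w t‖ ≤ Real.log (condNormSq w m t) := by
    have := Real.log_le_log (by positivity)
      (H.sqrt_eps_mul_le_condNormSq (H.t₀_nonneg.trans ht))
    rwa [Real.log_mul hε.ne' (by positivity), Real.log_pow, Nat.cast_ofNat] at this
  have h2 := mul_le_mul_of_nonneg_left h1 (show 0 ≤ L / 2 by positivity)
  linarith

lemma exists_logMargin_le (H : IsSeparatedPath ℓ q L a ε w m t₀) :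
    ∃ C : ℝ, ∀ t, t₀ ≤ t → logMargin ℓ q L a ε w m t ≤ C := by
  obtain ⟨C, hC⟩ := H.exists_log_lossInv_le
  refine ⟨C, fun t ht => ?_⟩
  have h2 : 0 ≤ L / 2 * (a / (2 * Real.sqrt ε)) * empiricalLoss ℓ q (w t) := by
    have := H.L_pos
    have := H.a_nonneg
    have := H.loss_pos (w t)
    positivity
  have := hC t ht
  unfold logMargin
  linarith

lemma tendsto_loss (H : IsSeparatedPath ℓ q L a ε w m t₀) :
    Tendsto (fun t => empiricalLoss ℓ q (w t)) atTop (𝓝[>] 0) := by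
  refine tendsto_nhdsWithin_iff.2 ⟨?_, Eventually.of_forall fun t => H.loss_pos (w t)⟩
  suffices h : ∀ l > 0, ∃ t, t₀ ≤ t ∧ empiricalLoss ℓ q (w t) < l by
    rw [Metric.tendsto_atTop]
    intro δ hδ
    obtain ⟨T, hT, hlt⟩ := h δ hδ
    refine ⟨T, fun t ht => ?_⟩
    rw [Real.dist_eq, sub_zero, abs_of_pos (H.loss_pos _)]
    exact (H.loss_anti (H.t₀_nonneg.trans hT) ht).trans_lt hlt
  intro l hl
  by_contra! hcon
  have hL := H.L_pos
  -- the margin and the norm are then bounded, so that the loss decreases at a linear rate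
  set Y := ℓ.lossInv l
  set y₀ := ℓ.lossInv (empiricalLoss ℓ q (w t₀)) with hy₀
  have hY : ∀ t, t₀ ≤ t → ℓ.lossInv (empiricalLoss ℓ q (w t)) ≤ Y := fun t ht =>
    ℓ.lossInv_anti hl (hcon t ht)
  set R := Real.exp ((Real.log Y - logMargin ℓ q L a ε w m t₀) / (L / 2))
  have hR : ∀ t, t₀ ≤ t → condNormSq w m t ≤ R := by
    intro t ht
    rw [← Real.log_le_iff_le_exp (H.condNormSq_pos ht), le_div_iff₀ (by positivity)]
    have := Real.log_le_log (H.lossInv_pos ht) (hY t ht)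
    have := H.log_lossInv_ge ht
    linarith
  have hy₀pos : 0 < y₀ := H.margin_pos
  have hν : ∀ t, t₀ ≤ t → y₀ * ℓ.slope Y ≤ marginSum ℓ q (w t) := by
    intro t ht
    refine le_trans ?_ (H.lossInv_mul_slope_le ht)
    have := ℓ.slope_pos Y
    exact mul_le_mul (H.lossInv_ge ht) (ℓ.slope_antitone (hY t ht)) this.le (H.lossInv_pos ht).le
  have hsY := ℓ.slope_pos Y
  have hRpos : 0 < R := Real.exp_pos _
  -- By Cauchy–Schwarz D ≥ (Lν)² / ρ², and `c` is this lower bound with ν ≥ y₀ · slope Y and ρ² ≤ R.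
  set c := (L * (y₀ * ℓ.slope Y)) ^ 2 / R with hc
  have hcpos : 0 < c := by positivity
  have key : ∀ t, t₀ ≤ t → empiricalLoss ℓ q (w t) + c * t ≤ empiricalLoss ℓ q (w t₀) + c * t₀ := by
    intro t ht
    refine H.le_of_regular (F := fun τ => empiricalLoss ℓ q (w τ) + c * τ) H.t₀_nonneg ht
      ((H.ac_loss H.t₀_nonneg ht).fun_add
        (ContDiffOn.absolutelyContinuousOnInterval (ContDiff.contDiffOn (by fun_prop)))) ?_
    intro τ hτ hreg
    have h0 : t₀ ≤ τ := hτ.1.le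
    obtain ⟨g, w', ξ, -, -, -, -, -, hd, hin, -⟩ :=
      H.exists_derivs (H.t₀_nonneg.trans h0) hreg
    refine ⟨_, ?_, hd.add ((hasDerivAt_id τ).const_mul c)⟩
    have h1 := H.sq_marginSum_le (H.t₀_nonneg.trans h0) hin
    have h2 : (L * (y₀ * ℓ.slope Y)) ^ 2 ≤ (L * marginSum ℓ q (w τ)) ^ 2 := by
      have := hν τ h0
      gcongr
    have hD0 : 0 ≤ ∑ j, (Real.sqrt (m j τ))⁻¹ * (g j) ^ 2 :=
      Finset.sum_nonneg fun j _ => by positivity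
    have h3 : c ≤ ∑ j, (Real.sqrt (m j τ))⁻¹ * (g j) ^ 2 := by
      rw [hc, div_le_iff₀ hRpos]
      exact h2.trans (h1.trans (mul_le_mul_of_nonneg_left (hR τ h0) hD0))
    linarith
  have hlt := H.loss_pos (w t₀)
  have h1 := key (t₀ + empiricalLoss ℓ q (w t₀) / c) (by
    have := div_pos hlt hcpos
    linarith)
  have h2 := H.loss_pos (w (t₀ + empiricalLoss ℓ q (w t₀) / c))
  have h3 : c * (t₀ + empiricalLoss ℓ q (w t₀) / c) = c * t₀ + empiricalLoss ℓ q (w t₀) := by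
    field_simp
  linarith

lemma tendsto_log_condNormSq (H : IsSeparatedPath ℓ q L a ε w m t₀) :
    Tendsto (fun t => Real.log (condNormSq w m t)) atTop atTop := by
  obtain ⟨C, hC⟩ := H.exists_log_lossInv_le
  have hL := H.L_pos
  have h1 : Tendsto (fun t => Real.log (ℓ.lossInv (empiricalLoss ℓ q (w t)))) atTop atTop :=
    Real.tendsto_log_atTop.comp (ℓ.tendsto_lossInv.comp H.tendsto_loss)
  have h2 : Tendsto (fun t => (Real.log (ℓ.lossInv (empiricalLoss ℓ q (w t))) + -C) / (L / 2))
      atTop atTop :=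
    (tendsto_atTop_add_const_right _ _ h1).atTop_div_const (by positivity)
  refine tendsto_atTop_mono' _ ?_ h2
  filter_upwards [eventually_ge_atTop t₀] with t ht
  rw [div_le_iff₀ (by positivity)]
  have := hC t ht
  linarith

lemma tendsto_norm (H : IsSeparatedPath ℓ q L a ε w m t₀) :
    Tendsto (fun t => ‖w t‖) atTop atTop := by
  obtain ⟨M, hM, hMle⟩ := H.exists_sqrt_m_le
  have h1 : Tendsto (fun t => Real.log ‖w t‖) atTop atTop := by
    have h2 : Tendsto (fun t => (Real.log (condNormSq w m t) + -Real.log M) / 2) atTop atTop :=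
      (tendsto_atTop_add_const_right _ _ H.tendsto_log_condNormSq).atTop_div_const two_pos
    refine tendsto_atTop_mono' _ ?_ h2
    filter_upwards [eventually_ge_atTop t₀] with t ht
    have hw := norm_pos_iff.2 (H.w_ne_zero ht)
    have h3 := Real.log_le_log (H.condNormSq_pos ht)
      (condNormSq_le fun j => hMle j t (H.t₀_nonneg.trans ht))
    rw [Real.log_mul hM.ne' (by positivity), Real.log_pow, Nat.cast_ofNat] at h3
    linarith
  refine (Real.tendsto_exp_atTop.comp h1).congr' ?_
  filter_upwards [eventually_ge_atTop t₀] with t ht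
  exact Real.exp_log (norm_pos_iff.2 (H.w_ne_zero ht))

/-- The squared inverse conditioner converges to `ε`. -/
lemma tendsto_m (H : IsSeparatedPath ℓ q L a ε w m t₀) (j : Fin p) :
    Tendsto (m j) atTop (𝓝 ε) := by
  -- When a = 0 there is no relaxation towards ε, but then the conditioner is constant.
  rcases H.a_nonneg.eq_or_lt with ha | ha
  · have : m j = fun _ => ε := funext fun t => H.m_const ha.symm j t
    rw [this]
    exact tendsto_const_nhds
  obtain ⟨M, hM, hMle⟩ := H.exists_sqrt_m_le
  -- A Lyapunov function: g_j² ≤ M D, so adding a M 𝓛 cancels the forcing term of m_j and leaves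
  -- only the relaxation.
  have hderiv : ∀ τ, 0 < τ → IsRegularTime ℓ q a ε w m τ → ∃ d ≤ -(a * (m j τ - ε)),
      HasDerivAt (fun τ => m j τ + a * M * empiricalLoss ℓ q (w τ)) d τ := by
    intro τ hτ hreg
    obtain ⟨g, w', ξ, -, -, -, -, hm, hd, -⟩ := H.exists_derivs hτ.le hreg
    refine ⟨_, ?_, (hm j).add (hd.const_mul (a * M))⟩
    have h1 : (Real.sqrt (m j τ))⁻¹ * (g j) ^ 2 ≤ ∑ j, (Real.sqrt (m j τ))⁻¹ * (g j) ^ 2 :=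
      Finset.single_le_sum (f := fun j => (Real.sqrt (m j τ))⁻¹ * (g j) ^ 2)
        (fun i _ => by positivity) (Finset.mem_univ j)
    have hr := H.sqrt_m_pos hτ.le j
    have h2 : (g j) ^ 2 ≤ M * ((Real.sqrt (m j τ))⁻¹ * (g j) ^ 2) := by
      calc (g j) ^ 2 = Real.sqrt (m j τ) * ((Real.sqrt (m j τ))⁻¹ * (g j) ^ 2) := by field_simp
        _ ≤ _ := by gcongr; exact hMle j τ hτ.le
    have h3 := mul_le_mul_of_nonneg_left (h2.trans (mul_le_mul_of_nonneg_left h1 hM.le)) ha.le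
    linarith
  have hac : ∀ s t, 0 ≤ s → s ≤ t → AbsolutelyContinuousOnInterval
      (fun τ => m j τ + a * M * empiricalLoss ℓ q (w τ)) s t := fun s t hs hst =>
    (H.ac_m j s t hs hst).fun_add ((H.ac_loss hs hst).const_mul _)
  have hanti : ∀ s t, 0 ≤ s → s ≤ t → m j t + a * M * empiricalLoss ℓ q (w t)
      ≤ m j s + a * M * empiricalLoss ℓ q (w s) := by
    intro s t hs hst
    refine H.le_of_regular hs hst (hac s t hs hst) fun τ hτ hreg => ?_
    have hτ0 : 0 < τ := hs.trans_lt hτ.1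
    obtain ⟨d, hd, hd'⟩ := hderiv τ hτ0 hreg
    refine ⟨d, hd.trans ?_, hd'⟩
    have := mul_nonneg ha.le (sub_nonneg.2 (H.le_m j τ hτ0.le))
    linarith
  -- Otherwise the positive Lyapunov function would decrease at least at rate a δ forever. Its
  -- monotonicity then upgrades arbitrarily late times to all later times.
  have hfreq : ∀ δ > 0, ∀ T, 0 ≤ T → ∃ t, T ≤ t ∧ m j t - ε < δ := by
    intro δ hδ T hT
    by_contra! hcon
    have hc : 0 < a * δ := mul_pos ha hδ
    set F := fun τ => m j τ + a * M * empiricalLoss ℓ q (w τ) with hF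
    have key : ∀ t, T ≤ t → F t + a * δ * t ≤ F T + a * δ * T := by
      intro t ht
      refine H.le_of_regular (F := fun τ => F τ + a * δ * τ) hT ht
        ((hac T t hT ht).fun_add
          (ContDiffOn.absolutelyContinuousOnInterval (ContDiff.contDiffOn (by fun_prop)))) ?_
      intro τ hτ hreg
      obtain ⟨d, hd, hd'⟩ := hderiv τ (hT.trans_lt hτ.1) hreg
      refine ⟨_, ?_, hd'.add ((hasDerivAt_id τ).const_mul (a * δ))⟩
      have := mul_le_mul_of_nonneg_left (hcon τ hτ.1.le) ha.le
      linarith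
    have hFpos : ∀ t, 0 ≤ t → 0 < F t := fun t ht =>
      add_pos (H.m_pos ht j) (mul_pos (mul_pos ha hM) (H.loss_pos _))
    have hFT := hFpos T hT
    have hq : 0 < F T / (a * δ) := div_pos hFT hc
    have h1 := key (T + F T / (a * δ)) (by linarith)
    have h2 := hFpos (T + F T / (a * δ)) (by linarith)
    have h3 : a * δ * (T + F T / (a * δ)) = a * δ * T + F T := by field_simp
    linarith
  rw [Metric.tendsto_atTop]
  intro δ hδ
  have hl : ∀ᶠ t in atTop, a * M * empiricalLoss ℓ q (w t) < δ / 2 := by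
    have : Tendsto (fun t => a * M * empiricalLoss ℓ q (w t)) atTop (𝓝 (a * M * 0)) :=
      (H.tendsto_loss.mono_right nhdsWithin_le_nhds).const_mul _
    exact this.eventually (gt_mem_nhds (by rw [mul_zero]; positivity))
  obtain ⟨T, hT⟩ := eventually_atTop.1 hl
  obtain ⟨t, ht, htδ⟩ := hfreq (δ / 2) (half_pos hδ) (max T 0) (le_max_right _ _)
  have ht0 : 0 ≤ t := (le_max_right _ _).trans ht
  refine ⟨t, fun s hs => ?_⟩
  have h1 := hanti t s ht0 hs
  have h2 := hT t ((le_max_left _ _).trans ht)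
  have h3 := H.le_m j s (ht0.trans hs)
  have h4 := mul_pos (mul_pos ha hM) (H.loss_pos (w s))
  rw [Real.dist_eq, abs_of_nonneg (by linarith)]
  linarith

end IsSeparatedPath

/-! ### The clock, the motion of the direction, and almost aligned times -/

namespace IsSeparatedPath

variable {p N : ℕ} {ℓ : LossKind} {q : Fin N → EuclideanSpace ℝ (Fin p) → ℝ} {L a ε : ℝ}
  {w : ℝ → EuclideanSpace ℝ (Fin p)} {m : Fin p → ℝ → ℝ} {t₀ t s : ℝ}

lemma continuousOn_of_ac {X : Type*} [SeminormedAddCommGroup X] {z : ℝ → X}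
    (h : ∀ s t, 0 ≤ s → s ≤ t → AbsolutelyContinuousOnInterval z s t) :
    ContinuousOn z (Set.Ici 0) := by
  intro t ht
  have ht : 0 ≤ t := ht
  have h1 := (h 0 (t + 1) le_rfl (by linarith)).continuousOn
  rw [Set.uIcc_of_le (by linarith)] at h1
  refine (h1 t ⟨ht, by linarith⟩).mono_of_mem_nhdsWithin ?_
  exact mem_nhdsWithin.2 ⟨Set.Iio (t + 1), isOpen_Iio, by simp, fun x hx => ⟨hx.2, hx.1.le⟩⟩

/-- A rescaled time `Θ` with `Θ' = ν / ρ²`, which measures the progress of the direction. -/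
lemma exists_clock (H : IsSeparatedPath ℓ q L a ε w m t₀) :
    ∃ Θ : ℝ → ℝ, ContDiff ℝ 1 Θ ∧
      (∀ t, t₀ ≤ t → HasDerivAt Θ (marginSum ℓ q (w t) / condNormSq w m t) t) ∧
      Tendsto Θ atTop atTop := by
  have hw : ContinuousOn w (Set.Ici t₀) :=
    (continuousOn_of_ac H.ac).mono (Set.Ici_subset_Ici.2 H.t₀_nonneg)
  have hν : Continuous (marginSum ℓ q) :=
    continuous_finsetSum _ fun i _ =>
      (ℓ.continuous_slope.comp (H.lip i).continuous).mul (H.lip i).continuous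
  have hρ : ContinuousOn (condNormSq w m) (Set.Ici t₀) :=
    (continuousOn_of_ac fun s t hs hst => H.ac_condNormSq hs hst).mono
      (Set.Ici_subset_Ici.2 H.t₀_nonneg)
  have hθ : ContinuousOn (fun t => marginSum ℓ q (w t) / condNormSq w m t) (Set.Ici t₀) :=
    (hν.comp_continuousOn hw).div hρ fun t ht => (H.condNormSq_pos ht).ne'
  -- Freezing the integrand before t₀ makes it continuous on the whole line, so that Θ is C¹
  -- everywhere.
  have hθ' : Continuous fun t => marginSum ℓ q (w (max t t₀)) / condNormSq w m (max t t₀) :=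
    hθ.comp_continuous (by fun_prop) fun t => le_max_right t t₀
  set Θ : ℝ → ℝ := fun t =>
    ∫ τ in t₀..t, marginSum ℓ q (w (max τ t₀)) / condNormSq w m (max τ t₀) with hΘ
  have hd : ∀ t, HasDerivAt Θ (marginSum ℓ q (w (max t t₀)) / condNormSq w m (max t t₀)) t :=
    fun t => intervalIntegral.integral_hasDerivAt_right (hθ'.intervalIntegrable _ _)
      hθ'.stronglyMeasurable.stronglyMeasurableAtFilter hθ'.continuousAt
  have hC : ContDiff ℝ 1 Θ := by
    refine contDiff_one_iff_deriv.2 ⟨fun t => (hd t).differentiableAt, ?_⟩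
    rwa [funext fun t => (hd t).deriv]
  have hd' : ∀ t, t₀ ≤ t → HasDerivAt Θ (marginSum ℓ q (w t) / condNormSq w m t) t := by
    intro t ht
    have := hd t
    rwa [max_eq_left ht] at this
  refine ⟨Θ, hC, hd', ?_⟩
  have hL := H.L_pos
  have ha := H.a_nonneg
  have hε := H.sqrt_eps_pos
  set c := a / (2 * Real.sqrt ε)
  have hc : 0 ≤ c := by positivity
  -- The clock dominates log ρ² / (2L) up to a bounded term, so it diverges with the norm.
  have key : ∀ t, t₀ ≤ t →
      Real.log (condNormSq w m t) + c * empiricalLoss ℓ q (w t) - 2 * L * Θ t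
      ≤ Real.log (condNormSq w m t₀) + c * empiricalLoss ℓ q (w t₀) - 2 * L * Θ t₀ := by
    intro t ht
    refine H.le_of_regular (F := fun τ => Real.log (condNormSq w m τ)
      + c * empiricalLoss ℓ q (w τ) - 2 * L * Θ τ) H.t₀_nonneg ht
      (((H.ac_log_condNormSq le_rfl ht).fun_add ((H.ac_loss H.t₀_nonneg ht).const_mul _)).fun_sub
        (ContDiffOn.absolutelyContinuousOnInterval (contDiff_const.mul hC).contDiffOn)) ?_
    intro τ hτ hreg
    have h0 : t₀ ≤ τ := hτ.1.le
    obtain ⟨g, w', ξ, -, -, -, -, -, hdl, hin, d, hr, hle⟩ :=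
      H.exists_derivs (H.t₀_nonneg.trans h0) hreg
    have hρτ := H.condNormSq_pos h0
    refine ⟨_, ?_, ((hr.log hρτ.ne').add (hdl.const_mul c)).sub ((hd' τ h0).const_mul (2 * L))⟩
    set D := ∑ j, (Real.sqrt (m j τ))⁻¹ * (g j) ^ 2
    have h3 : d / condNormSq w m τ
        ≤ 2 * L * (marginSum ℓ q (w τ) / condNormSq w m τ) + c * D := by
      calc d / condNormSq w m τ ≤ (2 * L * marginSum ℓ q (w τ)
            + c * D * condNormSq w m τ) / condNormSq w m τ := by gcongr
        _ = _ := by field_simp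
    linarith
  set C := Real.log (condNormSq w m t₀) + c * empiricalLoss ℓ q (w t₀) - 2 * L * Θ t₀
  have h2 : Tendsto (fun t => (Real.log (condNormSq w m t) + -C) / (2 * L)) atTop atTop :=
    (tendsto_atTop_add_const_right _ _ H.tendsto_log_condNormSq).atTop_div_const (by positivity)
  refine tendsto_atTop_mono' _ ?_ h2
  filter_upwards [eventually_ge_atTop t₀] with t ht
  rw [div_le_iff₀ (by positivity)]
  have h4 := key t ht
  have h5 := mul_nonneg hc (H.loss_pos (w t)).le
  linarith

lemma exists_norm_le_sum_slope (H : IsSeparatedPath ℓ q L a ε w m t₀) :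
    ∃ B : ℝ, 0 ≤ B ∧ ∀ x, x ≠ 0 → ∀ i, ∀ ξ ∈ clarkeSubdiff (q i) x,
      ‖ξ‖ ≤ B * ‖x‖ ^ (L - 1) := by
  choose B hB0 hB using fun i =>
    exists_norm_le_mul_norm_rpow_of_homogeneous (H.lip i) (H.hom i)
  refine ⟨∑ i, B i, Finset.sum_nonneg fun i _ => hB0 i, fun x hx i ξ hξ => ?_⟩
  refine (hB i x hx ξ hξ).trans ?_
  have : 0 ≤ ‖x‖ ^ (L - 1) := Real.rpow_nonneg (norm_nonneg _) _
  gcongr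
  exact Finset.single_le_sum (fun i _ => hB0 i) (Finset.mem_univ i)

/-- The relative speed of the flow is controlled by the rate of the clock. -/
lemma exists_speed_le (H : IsSeparatedPath ℓ q L a ε w m t₀) :
    ∃ K : ℝ, 0 ≤ K ∧ ∀ t, t₀ ≤ t → ∀ (g w' : EuclideanSpace ℝ (Fin p))
      (ξ : Fin N → EuclideanSpace ℝ (Fin p)), (∀ i, ξ i ∈ clarkeSubdiff (q i) (w t)) →
      g = -∑ i, ℓ.slope (q i (w t)) • ξ i → (∀ j, w' j = -((Real.sqrt (m j t))⁻¹ * g j)) →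
      2 * ‖w'‖ / ‖w t‖ ≤ K * (marginSum ℓ q (w t) / condNormSq w m t) := by
  obtain ⟨M, hM, hMle⟩ := H.exists_sqrt_m_le
  obtain ⟨B, hB0, hB⟩ := H.exists_norm_le_sum_slope
  obtain ⟨γ, hγ, hγle⟩ := H.exists_mul_norm_rpow_le
  have hε := H.sqrt_eps_pos
  refine ⟨2 * (Real.sqrt ε)⁻¹ * B * M / γ, by positivity, ?_⟩
  intro t ht g w' ξ hξ hg hw'
  have h0 := H.t₀_nonneg.trans ht
  have hn := norm_pos_iff.2 (H.w_ne_zero ht)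
  have hρ := H.condNormSq_pos ht
  have hS : 0 < ∑ i, ℓ.slope (q i (w t)) :=
    (ℓ.slope_pos _).trans_le (H.slope_lossInv_le (w t))
  set S := ∑ i, ℓ.slope (q i (w t)) with hSdef
  have h1 : ‖w'‖ ≤ (Real.sqrt ε)⁻¹ * ‖g‖ := by
    refine abs_le_of_sq_le_sq' ?_ (by positivity) |>.2
    rw [mul_pow, EuclideanSpace.real_norm_sq_eq, EuclideanSpace.real_norm_sq_eq, Finset.mul_sum]
    refine Finset.sum_le_sum fun j _ => ?_
    rw [hw' j, neg_sq, mul_pow]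
    have := H.sqrt_m_pos h0 j
    have := H.sqrt_eps_le h0 j
    gcongr
  have h2 : ‖g‖ ≤ B * ‖w t‖ ^ (L - 1) * S := by
    rw [hg, norm_neg, hSdef, Finset.mul_sum]
    refine (norm_sum_le _ _).trans (Finset.sum_le_sum fun i _ => ?_)
    have := ℓ.slope_pos (q i (w t))
    rw [norm_smul, Real.norm_eq_abs, abs_of_pos this, mul_comm]
    gcongr
    exact hB _ (H.w_ne_zero ht) i _ (hξ i)
  have h3 : γ * (‖w t‖ ^ (L - 1) * ‖w t‖) * S ≤ marginSum ℓ q (w t) := by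
    rw [← Real.rpow_add_one hn.ne', sub_add_cancel]
    refine le_trans ?_ (H.lossInv_mul_sum_slope_le (w t))
    gcongr
    exact hγle t ht
  have h4 : condNormSq w m t ≤ M * ‖w t‖ ^ 2 := condNormSq_le fun j => hMle j t h0
  have hr : 0 < ‖w t‖ ^ (L - 1) := Real.rpow_pos_of_pos hn _
  -- Both sides scale as S ‖w‖^(L-2): the speed is bounded through the subgradients, while ν ≥ γ
  -- ‖w‖^L S and ρ² ≤ M ‖w‖².
  calc 2 * ‖w'‖ / ‖w t‖
      ≤ 2 * ((Real.sqrt ε)⁻¹ * (B * ‖w t‖ ^ (L - 1) * S)) / ‖w t‖ := by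
        gcongr; exact h1.trans (by gcongr)
    _ = 2 * (Real.sqrt ε)⁻¹ * B * M / γ *
          (γ * (‖w t‖ ^ (L - 1) * ‖w t‖) * S / (M * ‖w t‖ ^ 2)) := by field_simp
    _ ≤ 2 * (Real.sqrt ε)⁻¹ * B * M / γ *
          (marginSum ℓ q (w t) / (M * ‖w t‖ ^ 2)) := by gcongr
    _ ≤ 2 * (Real.sqrt ε)⁻¹ * B * M / γ *
          (marginSum ℓ q (w t) / condNormSq w m t) := by
        have := H.marginSum_pos ht
        gcongr

lemma exists_hasDerivAt_normalize {E : Type*} [NormedAddCommGroup E] [InnerProductSpace ℝ E]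
    {z : ℝ → E} {z' : E} {t : ℝ} (hz : HasDerivAt z z' t) (h0 : z t ≠ 0) :
    ∃ d, HasDerivAt (fun τ => ‖z τ‖⁻¹ • z τ) d t ∧ ‖d‖ ≤ 2 * ‖z'‖ / ‖z t‖ := by
  have hn := norm_pos_iff.2 h0
  have h1 : HasDerivAt (fun τ => ‖z τ‖) (2 * inner ℝ (z t) z' / (2 * ‖z t‖)) t := by
    have h2 := (hz.norm_sq).sqrt (by positivity)
    simp only [Real.sqrt_sq (norm_nonneg _)] at h2
    exact h2
  refine ⟨_, (h1.inv hn.ne').smul hz, ?_⟩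
  refine (norm_add_le _ _).trans ?_
  rw [norm_smul, norm_smul, Pi.inv_apply, norm_inv, norm_norm, Real.norm_eq_abs]
  have h3 : |-(2 * inner ℝ (z t) z' / (2 * ‖z t‖)) / ‖z t‖ ^ 2| ≤ ‖z'‖ / ‖z t‖ ^ 2 := by
    rw [abs_div, abs_neg, abs_of_pos (show 0 < ‖z t‖ ^ 2 by positivity), abs_div,
      abs_of_pos (show 0 < 2 * ‖z t‖ by positivity), abs_mul, abs_two]
    gcongr
    rw [div_le_iff₀ (by positivity)]
    have := abs_real_inner_le_norm (z t) z'
    linarith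
  calc _ ≤ ‖z t‖⁻¹ * ‖z'‖ + ‖z'‖ / ‖z t‖ ^ 2 * ‖z t‖ := by gcongr
    _ = _ := by field_simp; ring

lemma norm_direction_sub_le (H : IsSeparatedPath ℓ q L a ε w m t₀) {Θ : ℝ → ℝ}
    (hΘ : ContDiff ℝ 1 Θ)
    (hΘ' : ∀ t, t₀ ≤ t → HasDerivAt Θ (marginSum ℓ q (w t) / condNormSq w m t) t) :
    ∃ K : ℝ, 0 ≤ K ∧ ∀ s t, t₀ ≤ s → s ≤ t →
      ‖‖w t‖⁻¹ • w t - ‖w s‖⁻¹ • w s‖ ≤ K * (Θ t - Θ s) := by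
  obtain ⟨K, hK0, hK⟩ := H.exists_speed_le
  refine ⟨K, hK0, fun s t hs hst => ?_⟩
  -- Pairing the direction with its own displacement reduces the vector estimate to a scalar
  -- monotonicity statement; dividing by ‖v‖ at the end gives the norm.
  set v := ‖w t‖⁻¹ • w t - ‖w s‖⁻¹ • w s with hv
  rcases eq_or_ne v 0 with hv0 | hv0
  · have hmono : Θ s ≤ Θ t := by
      have := H.le_of_regular (F := fun τ => -Θ τ) (H.t₀_nonneg.trans hs) hst
        (ContDiffOn.absolutelyContinuousOnInterval hΘ.neg.contDiffOn) fun τ hτ _ =>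
          ⟨_, neg_nonpos.2 (div_pos (H.marginSum_pos (hs.trans hτ.1.le))
            (H.condNormSq_pos (hs.trans hτ.1.le))).le, (hΘ' τ (hs.trans hτ.1.le)).neg⟩
      linarith
    rw [hv0, norm_zero]
    exact mul_nonneg hK0 (by linarith)
  have hvpos := norm_pos_iff.2 hv0
  have key := H.le_of_regular
    (F := fun τ => inner ℝ v (‖w τ‖⁻¹ • w τ) - ‖v‖ * K * Θ τ) (H.t₀_nonneg.trans hs) hst ?_ ?_
  · have h1 : inner ℝ v (‖w t‖⁻¹ • w t) - inner ℝ v (‖w s‖⁻¹ • w s) = ‖v‖ * ‖v‖ := by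
      rw [← inner_sub_right, ← hv, real_inner_self_eq_norm_mul_norm]
    refine le_of_mul_le_mul_left ?_ hvpos
    linarith
  · refine AbsolutelyContinuousOnInterval.fun_sub ?_
      (ContDiffOn.absolutelyContinuousOnInterval (contDiff_const.mul hΘ).contDiffOn)
    refine (H.ac s t (H.t₀_nonneg.trans hs) hst).contDiffAt_comp
      (F := fun x => inner ℝ v (‖x‖⁻¹ • x)) fun τ hτ => ?_
    rw [Set.uIcc_of_le hst] at hτ
    have h0 := H.w_ne_zero (hs.trans hτ.1)
    exact contDiffAt_const.inner ℝ
      (((contDiffAt_norm ℝ h0).inv (norm_ne_zero_iff.2 h0)).smul contDiffAt_id)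
  · intro τ hτ hreg
    have h0 : t₀ ≤ τ := hs.trans hτ.1.le
    obtain ⟨g, w', ξ, hξ, hg, hw', hw, -⟩ := H.exists_derivs (H.t₀_nonneg.trans h0) hreg
    obtain ⟨d, hd, hdle⟩ := exists_hasDerivAt_normalize hw (H.w_ne_zero h0)
    refine ⟨_, ?_, ((hasDerivAt_const τ v).inner ℝ hd).sub
      ((hΘ' τ h0).const_mul (‖v‖ * K))⟩
    have h1 := hdle.trans (hK τ h0 g w' ξ hξ hg hw')
    have h2 := real_inner_le_norm v d
    have h3 := mul_le_mul_of_nonneg_left h1 hvpos.le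
    simp only [inner_zero_left, add_zero]
    linarith

/-- Near a limit direction there are arbitrarily late times at which the gradient is almost
aligned with the parameters. -/
lemma exists_aligned_time (H : IsSeparatedPath ℓ q L a ε w m t₀)
    {wbar : EuclideanSpace ℝ (Fin p)}
    (hwbar : MapClusterPt wbar atTop (fun t : ℝ => ‖w t‖⁻¹ • w t)) {η : ℝ} (hη : 0 < η) (T₀ : ℝ) :
    ∃ t, T₀ ≤ t ∧ t₀ ≤ t ∧ ‖‖w t‖⁻¹ • w t - wbar‖ ≤ η ∧
      ∃ (g : EuclideanSpace ℝ (Fin p)) (ξ : Fin N → EuclideanSpace ℝ (Fin p)),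
        (∀ i, ξ i ∈ clarkeSubdiff (q i) (w t)) ∧ g = -∑ i, ℓ.slope (q i (w t)) • ξ i ∧
        (∑ j, (Real.sqrt (m j t))⁻¹ * (g j) ^ 2) * condNormSq w m t
          ≤ (L ^ 2 + η) * marginSum ℓ q (w t) ^ 2 := by
  obtain ⟨Θ, hΘ, hΘ', hΘtop⟩ := H.exists_clock
  obtain ⟨K, hK0, hK⟩ := H.norm_direction_sub_le hΘ hΘ'
  obtain ⟨C, hC⟩ := H.exists_logMargin_le
  -- Clock length of the window: the direction moves by at most K r ≤ η / 2, so a window starting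
  -- within η / 2 of the limit stays within η.
  set r := η / (2 * (K + 1)) with hr
  have hrpos : 0 < r := by positivity
  -- a time after which the smoothed margin grows by less than `η r`
  obtain ⟨T₁, hT₁, hgrow⟩ : ∃ T₁, t₀ ≤ T₁ ∧ ∀ t, T₁ ≤ t →
      logMargin ℓ q L a ε w m t < logMargin ℓ q L a ε w m T₁ + η * r := by
    set A := logMargin ℓ q L a ε w m '' Set.Ici t₀
    have hA : BddAbove A := ⟨C, by rintro _ ⟨t, ht, rfl⟩; exact hC t ht⟩
    have hne : A.Nonempty := ⟨_, t₀, Set.self_mem_Ici, rfl⟩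
    obtain ⟨_, ⟨T₁, hT₁, rfl⟩, hlt⟩ := exists_lt_of_lt_csSup hne
      (show sSup A - η * r < sSup A by have := mul_pos hη hrpos; linarith)
    refine ⟨T₁, hT₁, fun t ht => ?_⟩
    have := le_csSup hA ⟨t, (show t₀ ≤ T₁ from hT₁).trans ht, rfl⟩
    linarith
  have hfr := (hwbar.frequently (Metric.ball_mem_nhds wbar (half_pos hη))).and_eventually
    (eventually_ge_atTop (max T₀ T₁))
  obtain ⟨s, hsball, hsT⟩ := hfr.exists
  have hsT₀ := (le_max_left _ _).trans hsT
  have hsT₁ := (le_max_right _ _).trans hsT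
  have hst₀ := hT₁.trans hsT₁
  obtain ⟨s₁, hs₁, hss₁⟩ := ((hΘtop.eventually_ge_atTop (Θ s + r)).and
    (eventually_ge_atTop s)).exists
  -- The window from s to s' has clock length exactly r. If no time in it were aligned, `logMargin`
  -- would grow by at least η r, against the choice of T₁.
  obtain ⟨s', hs', hΘs'⟩ := intermediate_value_Icc hss₁ hΘ.continuous.continuousOn
    ⟨by linarith, hs₁⟩
  have hmono : ∀ u v, t₀ ≤ u → u ≤ v → Θ u ≤ Θ v := by
    intro u v hu huv
    have := H.le_of_regular (F := fun τ => -Θ τ) (H.t₀_nonneg.trans hu) huv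
      (ContDiffOn.absolutelyContinuousOnInterval hΘ.neg.contDiffOn) fun τ hτ _ =>
        ⟨_, neg_nonpos.2 (div_pos (H.marginSum_pos (hu.trans hτ.1.le))
          (H.condNormSq_pos (hu.trans hτ.1.le))).le, (hΘ' τ (hu.trans hτ.1.le)).neg⟩
    linarith
  by_contra! hcon
  have key := H.le_of_regular (F := fun τ => η * Θ τ - logMargin ℓ q L a ε w m τ)
    (H.t₀_nonneg.trans hst₀) hs'.1 ((ContDiffOn.absolutelyContinuousOnInterval
      (contDiff_const.mul hΘ).contDiffOn).fun_sub (H.ac_logMargin hst₀ hs'.1)) ?_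
  · have h1 := hgrow s' (hsT₁.trans hs'.1)
    have h2 := H.logMargin_mono hT₁ hsT₁
    simp only [hΘs'] at key
    linarith
  · intro τ hτ hreg
    have h0 : t₀ ≤ τ := hst₀.trans hτ.1.le
    obtain ⟨g, w', ξ, hξ, hg, -, -, -, hdl, hin, d, hrd, hle⟩ :=
      H.exists_derivs (H.t₀_nonneg.trans h0) hreg
    obtain ⟨e, he, hle'⟩ := H.exists_logMargin_deriv h0 hdl hrd hle
    refine ⟨_, ?_, ((hΘ' τ h0).const_mul η).sub he⟩
    have hdist : ‖‖w τ‖⁻¹ • w τ - wbar‖ ≤ η := by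
      have h1 := hK s τ hst₀ hτ.1.le
      have h2 : Θ τ ≤ Θ s' := hmono τ s' h0 hτ.2.le
      have h3 : K * (Θ τ - Θ s) ≤ K * r := by gcongr; linarith
      have h4 : K * r ≤ η / 2 := by
        rw [hr, mul_div_assoc', div_le_div_iff₀ (by positivity) two_pos]
        nlinarith
      have h5 : ‖‖w s‖⁻¹ • w s - wbar‖ < η / 2 := by
        rw [← dist_eq_norm]; exact hsball
      calc _ = ‖(‖w τ‖⁻¹ • w τ - ‖w s‖⁻¹ • w s) + (‖w s‖⁻¹ • w s - wbar)‖ := by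
            rw [sub_add_sub_cancel]
        _ ≤ _ := norm_add_le _ _
        _ ≤ η := by linarith
    have h6 := hcon τ (hsT₀.trans hτ.1.le) h0 hdist g ξ hξ hg
    have hν := H.marginSum_pos h0
    have hρ := H.condNormSq_pos h0
    have h7 : (L ^ 2 + η) * (marginSum ℓ q (w τ) / condNormSq w m τ)
        ≤ (∑ j, (Real.sqrt (m j τ))⁻¹ * (g j) ^ 2) / marginSum ℓ q (w τ) := by
      rw [mul_div_assoc', div_le_div_iff₀ hρ hν]
      linarith
    linarith

end IsSeparatedPath

/-! ### From limit directions to KKT points -/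

section KKT

variable {p N : ℕ} {q : Fin N → EuclideanSpace ℝ (Fin p) → ℝ} {L : ℝ}

lemma smul_mem_clarkeSubdiff_half_norm {v : EuclideanSpace ℝ (Fin p)} (hv : v ≠ 0) :
    (1 / (2 * ‖v‖)) • v ∈ clarkeSubdiff (fun u => 1 / 2 * ‖u‖) v := by
  refine HasStrictFDerivAt.mem_clarkeSubdiff ?_
  have hn := norm_pos_iff.2 hv
  have h1 : HasStrictFDerivAt (fun u : EuclideanSpace ℝ (Fin p) => 1 / 2 * ‖u‖)
      (fderiv ℝ (fun u : EuclideanSpace ℝ (Fin p) => 1 / 2 * ‖u‖) v) v :=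
    (contDiffAt_const.mul (contDiffAt_norm ℝ hv (n := 1))).hasStrictFDerivAt (by simp)
  have h2 : HasFDerivAt (fun u : EuclideanSpace ℝ (Fin p) => 1 / 2 * ‖u‖)
      (innerSL ℝ ((1 / (2 * ‖v‖)) • v)) v := by
    have h3 := ((hasStrictFDerivAt_norm_sq v).hasFDerivAt.sqrt (by positivity)).const_mul (1 / 2)
    simp only [Real.sqrt_sq (norm_nonneg _)] at h3
    refine h3.congr_fderiv ?_
    ext u
    simp
    field_simp
  rwa [h2.fderiv] at h1

lemma mem_clarkeSubdiff_half_norm_sq (v : EuclideanSpace ℝ (Fin p)) :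
    v ∈ clarkeSubdiff (fun u => 1 / 2 * ‖u‖ ^ 2) v := by
  refine HasStrictFDerivAt.mem_clarkeSubdiff ?_
  refine ((hasStrictFDerivAt_norm_sq v).const_mul (1 / 2)).congr_fderiv ?_
  ext u
  simp

/-- A direction which is a nonnegative combination of subgradients of the minimal margins is
the direction of a KKT point. -/
lemma exists_isKKTPoint (hN : 0 < N) (hL : 0 < L) (hLip : ∀ i, LocallyLipschitz (q i))
    (hHom : ∀ (i : Fin N) (α : ℝ) (u : EuclideanSpace ℝ (Fin p)),
      0 < α → q i (α • u) = α ^ L * q i u)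
    {x : EuclideanSpace ℝ (Fin p)} (hx : x ≠ 0) (hpos : ∀ i, 0 < q i x) {κ : ℝ} (hκ : 0 < κ)
    {μ : Fin N → ℝ} (hμ : ∀ i, 0 ≤ μ i) {ξ : Fin N → EuclideanSpace ℝ (Fin p)}
    (hξ : ∀ i, ξ i ∈ clarkeSubdiff (q i) x) (hsum : ∑ i, μ i • ξ i = κ • x)
    (hcomp : ∀ i k, q k x < q i x → μ i = 0) :
    ∃ (c : ℝ) (v : EuclideanSpace ℝ (Fin p)), 0 < c ∧ v = c • x ∧
      IsKKTPoint (fun u => 1 / 2 * ‖u‖) (fun i u => 1 - q i u) v ∧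
      IsKKTPoint (fun u => 1 / 2 * ‖u‖ ^ 2) (fun i u => 1 - q i u) v := by
  have : Nonempty (Fin N) := ⟨⟨0, hN⟩⟩
  obtain ⟨k, hk⟩ := Finite.exists_min fun i => q i x
  -- The scale at which the smallest margin becomes exactly one.
  set c := (q k x) ^ (-(1 / L)) with hc
  have hc0 : 0 < c := Real.rpow_pos_of_pos (hpos k) _
  have hcL : c ^ L = (q k x)⁻¹ := by
    rw [hc, ← Real.rpow_mul (hpos k).le, neg_mul, one_div_mul_cancel hL.ne', Real.rpow_neg_one]
  have hq : ∀ i, q i (c • x) = (q k x)⁻¹ * q i x := fun i => by rw [hHom i c x hc0, hcL]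
  have hv0 : c • x ≠ 0 := smul_ne_zero hc0.ne' hx
  have hcL' : 0 < c ^ (L - 1) := Real.rpow_pos_of_pos hc0 _
  -- both problems have the same constraints, and objectives with gradient `s • v`
  have key : ∀ (φ : EuclideanSpace ℝ (Fin p) → ℝ) (s : ℝ), 0 < s →
      s • (c • x) ∈ clarkeSubdiff φ (c • x) →
      IsKKTPoint φ (fun i u => 1 - q i u) (c • x) := by
    intro φ s hs hφ
    -- Subgradients at c • x carry a factor c^(L-1); this choice of multipliers undoes it and
    -- matches κ • x with s • (c • x).
    refine ⟨fun i => ?_, fun i => s * c / (κ * c ^ (L - 1)) * μ i, s • (c • x),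
      fun i => -(c ^ (L - 1) • ξ i), fun i => ?_, hφ, fun i => ?_, ?_, fun i => ?_⟩
    · simp only
      rw [hq i, sub_nonpos, inv_mul_eq_div, one_le_div (hpos k)]
      exact hk i
    · have := hμ i
      positivity
    · exact (hLip i).neg_mem_clarkeSubdiff_const_sub 1
        (smul_mem_clarkeSubdiff_of_homogeneous (hLip i) (hHom i) (hξ i) hc0)
    · have h1 : ∀ i, (s * c / (κ * c ^ (L - 1)) * μ i) • -(c ^ (L - 1) • ξ i)
          = -(s * c / κ) • (μ i • ξ i) := by
        intro i
        rw [smul_neg, smul_smul, smul_smul, ← neg_smul]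
        congr 1
        field_simp
      rw [Finset.sum_congr rfl fun i _ => h1 i, ← Finset.smul_sum, hsum, smul_smul, smul_smul,
        ← add_smul]
      have : s * c + -(s * c / κ) * κ = 0 := by field_simp; ring
      rw [this, zero_smul]
    · simp only
      rcases (hk i).eq_or_lt with h | h
      · rw [hq i, ← h, inv_mul_cancel₀ (hpos k).ne', sub_self, mul_zero]
      · rw [hcomp i k h, mul_zero, zero_mul]
  refine ⟨c, c • x, hc0, rfl, key _ (1 / (2 * ‖c • x‖)) ?_ ?_, key _ 1 one_pos ?_⟩
  · have := norm_pos_iff.2 hv0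
    positivity
  · exact smul_mem_clarkeSubdiff_half_norm hv0
  · rw [one_smul]
    exact mem_clarkeSubdiff_half_norm_sq _

/-- Approximate KKT conditions along a convergent sequence pass to the limit. -/
lemma exists_limit_multipliers (hLip : ∀ i, LocallyLipschitz (q i))
    {x : ℕ → EuclideanSpace ℝ (Fin p)} {xbar y : EuclideanSpace ℝ (Fin p)}
    (hx : Tendsto x atTop (𝓝 xbar)) {μ : ℕ → Fin N → ℝ} {C : ℝ}
    (hμ0 : ∀ n i, 0 ≤ μ n i) (hμC : ∀ n i, μ n i ≤ C)
    {ξ : ℕ → Fin N → EuclideanSpace ℝ (Fin p)}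
    (hξ : ∀ n i, ξ n i ∈ clarkeSubdiff (q i) (x n))
    (hsum : Tendsto (fun n => ∑ i, μ n i • ξ n i) atTop (𝓝 y))
    (hcomp : ∀ i k, q k xbar < q i xbar → Tendsto (fun n => μ n i) atTop (𝓝 0)) :
    ∃ (μ' : Fin N → ℝ) (ξ' : Fin N → EuclideanSpace ℝ (Fin p)), (∀ i, 0 ≤ μ' i) ∧
      (∀ i, ξ' i ∈ clarkeSubdiff (q i) xbar) ∧ ∑ i, μ' i • ξ' i = y ∧
      ∀ i k, q k xbar < q i xbar → μ' i = 0 := by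
  -- Compactness of the sequence with its limit bounds all subgradients at once, so multipliers and
  -- subgradients converge along one subsequence.
  have hK : IsCompact (insert xbar (Set.range x)) := hx.isCompact_insert_range
  choose B hB0 hB using fun i => (hLip i).exists_norm_clarkeSubdiff_le hK
  have hcompact : IsCompact ((Set.univ.pi fun _ : Fin N => Set.Icc (0 : ℝ) C) ×ˢ
      (Set.univ.pi fun i : Fin N =>
        Metric.closedBall (0 : EuclideanSpace ℝ (Fin p)) (B i))) :=
    (isCompact_univ_pi fun _ => isCompact_Icc).prod
      (isCompact_univ_pi fun i => isCompact_closedBall _ _)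
  obtain ⟨⟨μ', ξ'⟩, -, φ, hφ, hlim⟩ := hcompact.tendsto_subseq (x := fun n => (μ n, ξ n))
    fun n => ⟨fun i _ => ⟨hμ0 n i, hμC n i⟩, fun i _ => by
      rw [mem_closedBall_zero_iff]
      exact hB i _ (Set.mem_insert_of_mem _ ⟨n, rfl⟩) _ (hξ n i)⟩
  have hμ' : ∀ i, Tendsto (fun n => μ (φ n) i) atTop (𝓝 (μ' i)) := fun i =>
    (tendsto_pi_nhds.1 ((continuous_fst.tendsto _).comp hlim)) i
  have hξ' : ∀ i, Tendsto (fun n => ξ (φ n) i) atTop (𝓝 (ξ' i)) := fun i =>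
    (tendsto_pi_nhds.1 ((continuous_snd.tendsto _).comp hlim)) i
  have hφ' := hφ.tendsto_atTop
  refine ⟨μ', ξ', fun i => ge_of_tendsto' (hμ' i) fun n => hμ0 _ i, fun i => ?_, ?_, ?_⟩
  · exact (hLip i).mem_clarkeSubdiff_of_tendsto (hx.comp hφ') (hξ' i)
      (Eventually.of_forall fun n => hξ (φ n) i)
  · exact tendsto_nhds_unique (tendsto_finsetSum _ fun i _ => (hμ' i).smul (hξ' i))
      (hsum.comp hφ')
  · intro i k hik
    exact tendsto_nhds_unique (hμ' i) ((hcomp i k hik).comp hφ')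

end KKT

/-! ### Passage to the limit along almost aligned times -/

namespace IsSeparatedPath

variable {p N : ℕ} {ℓ : LossKind} {q : Fin N → EuclideanSpace ℝ (Fin p) → ℝ} {L a ε : ℝ}
  {w : ℝ → EuclideanSpace ℝ (Fin p)} {m : Fin p → ℝ → ℝ} {t₀ t : ℝ}

/-- Alignment of gradient and parameters, in coordinates. -/
lemma sq_sub_le_of_aligned (H : IsSeparatedPath ℓ q L a ε w m t₀) (ht : t₀ ≤ t) {M η : ℝ}
    (hM : 0 < M) (hMle : ∀ j, Real.sqrt (m j t) ≤ M) (hη : 0 ≤ η)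
    {g : EuclideanSpace ℝ (Fin p)} (hin : ∑ j, g j * w t j = -(L * marginSum ℓ q (w t)))
    (hal : (∑ j, (Real.sqrt (m j t))⁻¹ * (g j) ^ 2) * condNormSq w m t
          ≤ (L ^ 2 + η) * marginSum ℓ q (w t) ^ 2) (j : Fin p) :
    (-(condNormSq w m t / (L * marginSum ℓ q (w t) * ‖w t‖)) * g j
      - Real.sqrt (m j t) * (‖w t‖⁻¹ * w t j)) ^ 2 ≤ M ^ 2 / L ^ 2 * η := by
  have h0 := H.t₀_nonneg.trans ht
  have hν := H.marginSum_pos ht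
  have hρ := H.condNormSq_pos ht
  have hn := norm_pos_iff.2 (H.w_ne_zero ht)
  have hL := H.L_pos
  have hρle : condNormSq w m t ≤ M * ‖w t‖ ^ 2 := condNormSq_le hMle
  set D := ∑ j, (Real.sqrt (m j t))⁻¹ * (g j) ^ 2 with hD
  set ν := marginSum ℓ q (w t)
  set R := condNormSq w m t with hR
  set s := L * ν / R with hs
  have hspos : 0 < s := by positivity
  -- The Cauchy–Schwarz defect as a square: s is the coefficient that minimizes the distance of g
  -- from -s (√m_j w_j) in the weighted norm.
  have h1 : ∑ j, (Real.sqrt (m j t))⁻¹ * (g j + s * (Real.sqrt (m j t) * w t j)) ^ 2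
      = D - L ^ 2 * ν ^ 2 / R := by
    have e : ∀ j, (Real.sqrt (m j t))⁻¹ * (g j + s * (Real.sqrt (m j t) * w t j)) ^ 2
        = (Real.sqrt (m j t))⁻¹ * (g j) ^ 2 + 2 * s * (g j * w t j)
          + s ^ 2 * (Real.sqrt (m j t) * (w t j) ^ 2) := by
      intro j
      have := (H.sqrt_m_pos h0 j).ne'
      field_simp
      ring
    rw [Finset.sum_congr rfl fun j _ => e j, Finset.sum_add_distrib, Finset.sum_add_distrib,
      ← Finset.mul_sum, ← Finset.mul_sum, hin]
    change D + _ + s ^ 2 * R = _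
    rw [hs]
    field_simp
    ring
  have h2 : D - L ^ 2 * ν ^ 2 / R ≤ η * ν ^ 2 / R := by
    rw [sub_le_iff_le_add, ← add_div, le_div_iff₀ hρ]
    linarith
  have h3 : (g j + s * (Real.sqrt (m j t) * w t j)) ^ 2 ≤ M * (η * ν ^ 2 / R) := by
    have hr := H.sqrt_m_pos h0 j
    have h4 := Finset.single_le_sum
      (f := fun j => (Real.sqrt (m j t))⁻¹ * (g j + s * (Real.sqrt (m j t) * w t j)) ^ 2)
      (fun i _ => by positivity) (Finset.mem_univ j)
    have h5 : 0 ≤ η * ν ^ 2 / R := by positivity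
    calc _ = Real.sqrt (m j t) * ((Real.sqrt (m j t))⁻¹ *
          (g j + s * (Real.sqrt (m j t) * w t j)) ^ 2) := by field_simp
      _ ≤ Real.sqrt (m j t) * (η * ν ^ 2 / R) :=
          mul_le_mul_of_nonneg_left (h4.trans (h1.le.trans h2)) hr.le
      _ ≤ _ := by gcongr; exact hMle j
  have e : (-(R / (L * ν * ‖w t‖)) * g j - Real.sqrt (m j t) * (‖w t‖⁻¹ * w t j)) ^ 2
      = (R / (L * ν * ‖w t‖)) ^ 2 * (g j + s * (Real.sqrt (m j t) * w t j)) ^ 2 := by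
    rw [← mul_pow, ← neg_sq]
    congr 1
    rw [hs]
    field_simp
    ring
  rw [e]
  calc _ ≤ (R / (L * ν * ‖w t‖)) ^ 2 * (M * (η * ν ^ 2 / R)) := by gcongr
    _ = M / L ^ 2 * η * (R / ‖w t‖ ^ 2) := by field_simp
    _ ≤ M / L ^ 2 * η * M := by
        gcongr
        rwa [div_le_iff₀ (by positivity)]
    _ = _ := by ring

/-- Limit directions of the flow are directions of KKT points. -/
theorem exists_isKKTPoint_of_mapClusterPt (H : IsSeparatedPath ℓ q L a ε w m t₀)
    {wbar : EuclideanSpace ℝ (Fin p)}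
    (hwbar : MapClusterPt wbar atTop (fun t : ℝ => ‖w t‖⁻¹ • w t)) :
    ∃ (c : ℝ) (v : EuclideanSpace ℝ (Fin p)), 0 < c ∧ v = c • wbar ∧
      IsKKTPoint (fun u => 1 / 2 * ‖u‖) (fun i u => 1 - q i u) v ∧
      IsKKTPoint (fun u => 1 / 2 * ‖u‖ ^ 2) (fun i u => 1 - q i u) v := by
  have hη : ∀ n : ℕ, (0 : ℝ) < 1 / ((n : ℝ) + 1) := fun n => by positivity
  have hη0 : Tendsto (fun n : ℕ => 1 / ((n : ℝ) + 1)) atTop (𝓝 0) :=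
    tendsto_one_div_add_atTop_nhds_zero_nat
  choose T hTn hT₀ hTdir g ξ hξ hg hal using fun n : ℕ =>
    H.exists_aligned_time hwbar (hη n) (n : ℝ)
  obtain ⟨M, hM, hMle⟩ := H.exists_sqrt_m_le
  obtain ⟨γ, hγ, hγle⟩ := H.exists_mul_norm_rpow_le
  have hL := H.L_pos
  have hTtop : Tendsto T atTop atTop := tendsto_atTop_mono hTn tendsto_natCast_atTop_atTop
  have hT0 : ∀ n, 0 ≤ T n := fun n => H.t₀_nonneg.trans (hT₀ n)
  have hn : ∀ n, 0 < ‖w (T n)‖ := fun n => norm_pos_iff.2 (H.w_ne_zero (hT₀ n))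
  have hν : ∀ n, 0 < marginSum ℓ q (w (T n)) := fun n => H.marginSum_pos (hT₀ n)
  have hρ : ∀ n, 0 < condNormSq w m (T n) := fun n => H.condNormSq_pos (hT₀ n)
  set x : ℕ → EuclideanSpace ℝ (Fin p) := fun n => ‖w (T n)‖⁻¹ • w (T n) with hxdef
  have hx : Tendsto x atTop (𝓝 wbar) := by
    rw [tendsto_iff_norm_sub_tendsto_zero]
    exact squeeze_zero (fun n => norm_nonneg _) hTdir hη0
  have hxnorm : ∀ n, ‖x n‖ = 1 := fun n => by
    simp [hxdef, norm_smul, (hn n).ne']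
  have hwnorm : ‖wbar‖ = 1 := by
    refine tendsto_nhds_unique hx.norm ?_
    simp only [hxnorm]
    exact tendsto_const_nhds
  have hwbar0 : wbar ≠ 0 := norm_pos_iff.1 (by rw [hwnorm]; exact one_pos)
  have hqx : ∀ n i, q i (w (T n)) = ‖w (T n)‖ ^ L * q i (x n) := fun n i =>
    eq_norm_rpow_mul_of_homogeneous (H.hom i) (H.w_ne_zero (hT₀ n))
  have hqpos : ∀ n i, 0 < q i (w (T n)) := fun n i =>
    (H.lossInv_pos (hT₀ n)).trans_le (H.lossInv_le_margin _ i)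
  have hqbar : ∀ i, 0 < q i wbar := by
    intro i
    refine hγ.trans_le (ge_of_tendsto' (((H.lip i).continuous.tendsto wbar).comp hx) fun n => ?_)
    have h1 := (hγle (T n) (hT₀ n)).trans (H.lossInv_le_margin (w (T n)) i)
    rw [hqx n i, mul_comm] at h1
    exact le_of_mul_le_mul_left h1 (Real.rpow_pos_of_pos (hn n) _)
  -- rescaled subgradients and multipliers
  set ζ : ℕ → Fin N → EuclideanSpace ℝ (Fin p) :=
    fun n i => (‖w (T n)‖⁻¹) ^ (L - 1) • ξ n i with hζdef
  have hζ : ∀ n i, ζ n i ∈ clarkeSubdiff (q i) (x n) := fun n i =>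
    smul_mem_clarkeSubdiff_of_homogeneous (H.lip i) (H.hom i) (hξ n i) (inv_pos.2 (hn n))
  -- At an aligned time g is close to -(Lν/ρ²)(√m_j w_j), so A n normalizes -g to approximate the
  -- unit direction weighted by √m_j.
  set A : ℕ → ℝ := fun n =>
    condNormSq w m (T n) / (L * marginSum ℓ q (w (T n)) * ‖w (T n)‖) with hAdef
  have hA : ∀ n, 0 < A n := fun n =>
    div_pos (hρ n) (mul_pos (mul_pos hL (hν n)) (hn n))
  have hrp : ∀ n, 0 < ‖w (T n)‖ ^ (L - 1) := fun n => Real.rpow_pos_of_pos (hn n) _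
  set μ : ℕ → Fin N → ℝ :=
    fun n i => A n * ‖w (T n)‖ ^ (L - 1) * ℓ.slope (q i (w (T n))) with hμdef
  have hμ0 : ∀ n i, 0 ≤ μ n i := fun n i =>
    (mul_pos (mul_pos (hA n) (hrp n)) (ℓ.slope_pos _)).le
  -- The powers of ‖w‖ cancel between ρ² ≤ M ‖w‖² and ν ≥ γ ‖w‖^L · slope.
  have hμC : ∀ n i, μ n i ≤ M / (L * γ) := by
    intro n i
    have h1 : ℓ.slope (q i (w (T n))) ≤ ∑ i, ℓ.slope (q i (w (T n))) :=
      Finset.single_le_sum (f := fun i => ℓ.slope (q i (w (T n))))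
        (fun i _ => (ℓ.slope_pos _).le) (Finset.mem_univ i)
    have h2 : γ * (‖w (T n)‖ ^ (L - 1) * ‖w (T n)‖) * ℓ.slope (q i (w (T n)))
        ≤ marginSum ℓ q (w (T n)) := by
      rw [← Real.rpow_add_one (hn n).ne', sub_add_cancel]
      refine le_trans ?_ (H.lossInv_mul_sum_slope_le (w (T n)))
      have := (ℓ.slope_pos (q i (w (T n)))).le
      have := (H.lossInv_pos (hT₀ n)).le
      exact mul_le_mul (hγle _ (hT₀ n)) h1 (by assumption) (by assumption)
    have h3 : condNormSq w m (T n) ≤ M * ‖w (T n)‖ ^ 2 :=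
      condNormSq_le fun j => hMle j _ (hT0 n)
    have hn' := hn n
    have hν' := hν n
    have hr' := hrp n
    have hs' := ℓ.slope_pos (q i (w (T n)))
    simp only [hμdef, hAdef]
    calc condNormSq w m (T n) / (L * marginSum ℓ q (w (T n)) * ‖w (T n)‖)
          * ‖w (T n)‖ ^ (L - 1) * ℓ.slope (q i (w (T n)))
        ≤ M * ‖w (T n)‖ ^ 2 / (L * marginSum ℓ q (w (T n)) * ‖w (T n)‖)
          * ‖w (T n)‖ ^ (L - 1) * ℓ.slope (q i (w (T n))) := by gcongr
      _ = M / (L * γ) * (γ * (‖w (T n)‖ ^ (L - 1) * ‖w (T n)‖) * ℓ.slope (q i (w (T n)))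
          / marginSum ℓ q (w (T n))) := by field_simp
      _ ≤ M / (L * γ) * 1 := by
          gcongr
          rwa [div_le_one hν']
      _ = _ := mul_one _
  have hsum_eq : ∀ n, ∑ i, μ n i • ζ n i = -(A n) • g n := by
    intro n
    rw [hg n, neg_smul, smul_neg, neg_neg, Finset.smul_sum]
    refine Finset.sum_congr rfl fun i _ => ?_
    rw [hζdef, hμdef]
    simp only [smul_smul]
    congr 1
    rw [Real.inv_rpow (hn n).le]
    have := (hrp n).ne'
    field_simp
  have hsum : Tendsto (fun n => ∑ i, μ n i • ζ n i) atTop (𝓝 (Real.sqrt ε • wbar)) := by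
    have hj : ∀ j, Tendsto (fun n => (∑ i, μ n i • ζ n i) j) atTop
        (𝓝 ((Real.sqrt ε • wbar) j)) := by
      intro j
      have hxj : Tendsto (fun n => x n j) atTop (𝓝 (wbar j)) :=
        ((PiLp.continuous_apply 2 (fun _ : Fin p => ℝ) j).tendsto wbar).comp hx
      have h1 : Tendsto (fun n => Real.sqrt (m j (T n)) * x n j) atTop
          (𝓝 (Real.sqrt ε * wbar j)) :=
        ((Real.continuous_sqrt.tendsto ε).comp ((H.tendsto_m j).comp hTtop)).mul hxj
      have h2 : Tendsto (fun n => (∑ i, μ n i • ζ n i) j - Real.sqrt (m j (T n)) * x n j) atTop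
          (𝓝 0) := by
        have h3 : Tendsto (fun n : ℕ => Real.sqrt (M ^ 2 / L ^ 2 * (1 / ((n : ℝ) + 1))))
            atTop (𝓝 0) := by
          have := (Real.continuous_sqrt.tendsto _).comp (hη0.const_mul (M ^ 2 / L ^ 2))
          rwa [mul_zero, Real.sqrt_zero] at this
        refine squeeze_zero_norm (fun n => ?_) h3
        refine Real.le_sqrt_of_sq_le ?_
        rw [Real.norm_eq_abs, sq_abs, hsum_eq n]
        exact H.sq_sub_le_of_aligned (hT₀ n) hM (fun j => hMle j _ (hT0 n)) (hη n).le
          (H.inner_grad_self (hξ n) (hg n)) (hal n) j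
      have h4 := h2.add h1
      simp only [sub_add_cancel, zero_add] at h4
      exact h4
    have h5 := ((PiLp.continuous_toLp 2 (fun _ : Fin p => ℝ)).tendsto _).comp
      (tendsto_pi_nhds.2 hj)
    exact h5
  -- A strict gap between margins at the limit becomes a gap of order ‖w‖^L along the flow, and μ n
  -- i / μ n k is at most twice the exponential of minus that gap.
  have hcomp : ∀ i k, q k wbar < q i wbar → Tendsto (fun n => μ n i) atTop (𝓝 0) := by
    intro i k hik
    have hdiff : Tendsto (fun n => q i (w (T n)) - q k (w (T n))) atTop atTop := by
      have h1 : Tendsto (fun n => ‖w (T n)‖ ^ L) atTop atTop :=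
        (tendsto_rpow_atTop hL).comp (H.tendsto_norm.comp hTtop)
      have h2 : Tendsto (fun n => q i (x n) - q k (x n)) atTop (𝓝 (q i wbar - q k wbar)) :=
        (((H.lip i).continuous.tendsto _).comp hx).sub (((H.lip k).continuous.tendsto _).comp hx)
      refine (h1.atTop_mul_pos (sub_pos.2 hik) h2).congr fun n => ?_
      rw [hqx n i, hqx n k]
      ring
    have h3 : Tendsto (fun n => 2 * Real.exp (-(q i (w (T n)) - q k (w (T n)))) * (M / (L * γ)))
        atTop (𝓝 (2 * 0 * (M / (L * γ)))) :=
      ((Real.tendsto_exp_neg_atTop_nhds_zero.comp hdiff).const_mul 2).mul_const _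
    rw [mul_zero, zero_mul] at h3
    refine squeeze_zero (fun n => hμ0 n i) (fun n => ?_) h3
    calc μ n i ≤ A n * ‖w (T n)‖ ^ (L - 1) *
          (2 * Real.exp (-(q i (w (T n)) - q k (w (T n)))) * ℓ.slope (q k (w (T n)))) :=
          mul_le_mul_of_nonneg_left (ℓ.slope_le _ (hqpos n k).le)
            (mul_pos (hA n) (hrp n)).le
      _ = 2 * Real.exp (-(q i (w (T n)) - q k (w (T n)))) * μ n k := by
          simp only [hμdef]; ring
      _ ≤ _ := by
          gcongr
          exact hμC n k
  obtain ⟨μ', ξ', hμ', hξ', hsum', hcomp'⟩ :=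
    exists_limit_multipliers H.lip hx hμ0 hμC hζ hsum hcomp
  exact exists_isKKTPoint H.N_pos hL H.lip H.hom hwbar0 hqbar H.sqrt_eps_pos hμ' hξ' hsum' hcomp'

end IsSeparatedPath

theorem mainTheorem3 {p N : ℕ} (hN : 0 < N) (ℓ : LossKind)
    (q : Fin N → EuclideanSpace ℝ (Fin p) → ℝ)
    (hLip : ∀ i, LocallyLipschitz (q i))
    (hChain : ∀ i, AdmitsChainRule (q i))
    (hHom : ∃ L : ℝ, 0 < L ∧ ∀ (i : Fin N) (α : ℝ) (u : EuclideanSpace ℝ (Fin p)),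
      0 < α → q i (α • u) = α ^ L * q i u)
    (b ε : ℝ) (hb0 : 0 ≤ b) (hb1 : b ≤ 1) (hε : 0 < ε)
    (w : ℝ → EuclideanSpace ℝ (Fin p))
    (hflow : IsRMSPropFlow b ε (empiricalLoss ℓ q) w)
    (hSep : ∃ t₀ : ℝ, 0 ≤ t₀ ∧ 0 < ℓ.fInv (Real.log (1 / empiricalLoss ℓ q (w t₀))))
    (wbar : EuclideanSpace ℝ (Fin p))
    (hwbar : MapClusterPt wbar atTop (fun t : ℝ => ‖w t‖⁻¹ • w t)) :
    ∃ (c : ℝ) (v : EuclideanSpace ℝ (Fin p)), 0 < c ∧ v = c • wbar ∧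
      IsKKTPoint (fun u => 1 / 2 * ‖u‖) (fun i u => 1 - q i u) v ∧
      IsKKTPoint (fun u => 1 / 2 * ‖u‖ ^ 2) (fun i u => 1 - q i u) v := by
  obtain ⟨L, hL, hHom⟩ := hHom
  obtain ⟨t₀, ht₀, hpos⟩ := hSep
  obtain ⟨m, hm⟩ := hflow.exists_isRMSPath hN hLip hChain hb1
  have : Nonempty (Fin N) := ⟨⟨0, hN⟩⟩
  have hloss : 0 < empiricalLoss ℓ q (w t₀) :=
    Finset.sum_pos (fun i _ => ℓ.loss_pos _) Finset.univ_nonempty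
  rw [ℓ.fInv_log_one_div hloss] at hpos
  have H : IsSeparatedPath ℓ q L (1 - b) ε w m t₀ :=
    { toIsRMSPath := hm
      lip := hLip
      N_pos := hN
      L_pos := hL
      hom := hHom
      a_nonneg := by linarith
      eps_pos := hε
      t₀_nonneg := ht₀
      margin_pos := hpos }
  exact H.exists_isKKTPoint_of_mapClusterPt hwbar
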